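/- Let $d\in\{1,2\}$, $N\in\mathbb N$, $m\in\mathbb R$, $r\in(0,1)$, $c_0>0$, and let $$c(z,x,\tau)=c_0+\sum_{l=1}^N c_l(z,x)\,h_l(\tau)\qquad (z\ge 0,\ x\in\mathbb R^d,\ \tau\in\mathbb R),$$ where, for $l=1,\dots,N$, $h_l$ is a real-valued smooth symbol of order $m$ on $\mathbb R$ (that is, $|\partial_\tau^k h_l(\tau)|=O(|\tau|^{m-k})$ as $|\tau|\to\infty$ for all $k\in\mathbb N_0$) with $|h_l|\ge\eta_0$ near $\tau=0$ for some constant $\eta_0>0$; $c_l$ is real-valued and belongs to $C^1([0,\infty),H^{r+1}(\mathbb R^d))$; and, for all $z\ge 0$ and $\tau\in\mathbb R$, $c(z,x,\tau)\ge c_0$ for almost every $x\in\mathbb R^d$. For $\tau\in\mathbb R$ and $z\ge0$ let $A(\tau;z)v=\operatorname{div}(c(z,\cdot,\tau)\nabla v)$, as an unbounded operator on $L^2(\mathbb R^d)$ with domain $H^2(\mathbb R^d)$. Let $Z>0$. Then for every $\tau\in\mathbb R$ there is exactly one family $(U(\tau;z_1,z_2))_{Z\ge z_1\ge z_2\ge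 0}$ of bounded linear operators on $L^2(\mathbb R^d)$ (the evolution system of $(iA(\tau;z))_{z}$) with the following properties: 1. the map $(z_1,z_2)\mapsto U(\tau;z_1,z_2)$ is strongly continuous, $U(\tau;z,z)=I$ for $0\le z\le Z$, and $\|U(\tau;z_1,z_2)\|\le 1$; 2. $U(\tau;z_1,z_2)\,U(\tau;z_2,z_3)=U(\tau;z_1,z_3)$ for $0\le z_3\le z_2\le z_1\le Z$; 3. $H^2(\mathbb R^d)$ is invariant under every $U(\tau;z_1,z_2)$; 4. for every $v\in H^2(\mathbb R^d)$ the map $(z_1,z_2)\mapsto U(\tau;z_1,z_2)v\in L^2(\mathbb R^d)$ is continuously differentiable separately in $z_1\in[z_2,Z]$ and in $z_2\in[0,z_1]$ (one-sided derivatives at end points), and $$\partial_{z_1}U(\tau;z_1,z_2)v=iA(\tau;z_1)U(\tau;z_1,z_2)v,\qquad \partial_{z_2}U(\tau;z_1,z_2)v=-U(\tau;z_1,z_2)\,iA(\tau;z_2)v .$$ -/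

import Mathlib

open MeasureTheory Set
open scoped SchwartzMap LineDeriv ContDiff

noncomputable section

namespace Paraxial

/-- The lateral space `ℝ^d`. -/
abbrev E (d : ℕ) : Type := EuclideanSpace ℝ (Fin d)

/-- The complex Hilbert space `L²(ℝ^d)`. -/
abbrev L2 (d : ℕ) : Type := Lp ℂ 2 (volume : Measure (E d))

/-- The tempered distributions in the Sobolev space `H^s(ℝ^d)`, as a subspace of `𝓢'(ℝ^d)`. -/
def sobolevSubmodule (d : ℕ) (s : ℝ) : Submodule ℂ 𝓢'(E d, ℂ) where
  carrier := {u | TemperedDistribution.MemSobolev s 2 u}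
  add_mem' := fun hu hv => hu.add hv
  zero_mem' := TemperedDistribution.memSobolev_fun_zero (E d) ℂ s 2
  smul_mem' := fun a _ hu => hu.smul a

/-- The Sobolev space `H^s(ℝ^d)`. It gets below the norm
`‖u‖_{H^s} = ‖𝓕⁻¹ (1 + |ξ|²)^(s/2) 𝓕 u‖_{L²}`. -/
def Sobolev (d : ℕ) (s : ℝ) : Type := ↥(sobolevSubmodule d s)

instance (d : ℕ) (s : ℝ) : AddCommGroup (Sobolev d s) :=
  inferInstanceAs (AddCommGroup ↥(sobolevSubmodule d s))

instance (d : ℕ) (s : ℝ) : Module ℂ (Sobolev d s) :=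
  inferInstanceAs (Module ℂ ↥(sobolevSubmodule d s))

/-- The tempered distribution underlying an element of `H^s(ℝ^d)`. -/
def Sobolev.toDistribution {d : ℕ} {s : ℝ} : Sobolev d s →ₗ[ℂ] 𝓢'(E d, ℂ) :=
  (sobolevSubmodule d s).subtype

theorem L2.toTemperedDistribution_injective (d : ℕ) :
    Function.Injective (fun f : L2 d => (f : 𝓢'(E d, ℂ))) :=
  LinearMap.ker_eq_bot.mp
    (Lp.ker_toTemperedDistributionCLM_eq_bot (F := ℂ) (μ := (volume : Measure (E d))) (p := 2))

theorem Sobolev.exists_bessel {d : ℕ} {s : ℝ} (u : Sobolev d s) :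
    ∃ f : L2 d, TemperedDistribution.besselPotential (E d) ℂ s u.toDistribution = f :=
  u.2

/-- The map `u ↦ 𝓕⁻¹ (1 + |ξ|²)^(s/2) 𝓕 u` from `H^s(ℝ^d)` to `L²(ℝ^d)`. -/
def Sobolev.bessel {d : ℕ} {s : ℝ} : Sobolev d s →ₗ[ℂ] L2 d where
  toFun u := u.exists_bessel.choose
  map_add' u v := by
    apply L2.toTemperedDistribution_injective d
    refine (u + v).exists_bessel.choose_spec.symm.trans ?_
    refine Eq.trans ?_ (map_add (Lp.toTemperedDistributionCLM ℂ volume 2) _ _).symm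
    rw [map_add, map_add]
    exact congrArg₂ (· + ·) u.exists_bessel.choose_spec v.exists_bessel.choose_spec
  map_smul' a u := by
    apply L2.toTemperedDistribution_injective d
    refine (a • u).exists_bessel.choose_spec.symm.trans ?_
    refine Eq.trans ?_ (map_smul (Lp.toTemperedDistributionCLM ℂ volume 2) a _).symm
    rw [map_smul, map_smul]
    exact congrArg (a • ·) u.exists_bessel.choose_spec

theorem Sobolev.coe_bessel {d : ℕ} {s : ℝ} (u : Sobolev d s) :
    ((Sobolev.bessel u : L2 d) : 𝓢'(E d, ℂ)) =
      TemperedDistribution.besselPotential (E d) ℂ s u.toDistribution :=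
  u.exists_bessel.choose_spec.symm

theorem Sobolev.bessel_injective {d : ℕ} {s : ℝ} :
    Function.Injective (Sobolev.bessel : Sobolev d s →ₗ[ℂ] L2 d) := by
  intro u v h
  have h1 : TemperedDistribution.besselPotential (E d) ℂ s u.toDistribution =
      TemperedDistribution.besselPotential (E d) ℂ s v.toDistribution := by
    rw [← Sobolev.coe_bessel, ← Sobolev.coe_bessel, h]
  have h2 := congrArg (TemperedDistribution.besselPotential (E d) ℂ (-s)) h1
  simp only [TemperedDistribution.besselPotential_besselPotential_apply, add_neg_cancel,
    TemperedDistribution.besselPotential_zero, ContinuousLinearMap.id_apply] at h2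
  exact Subtype.ext h2

instance (d : ℕ) (s : ℝ) : NormedAddCommGroup (Sobolev d s) :=
  NormedAddCommGroup.induced (Sobolev d s) (L2 d) Sobolev.bessel Sobolev.bessel_injective

instance (d : ℕ) (s : ℝ) : NormedSpace ℂ (Sobolev d s) :=
  NormedSpace.induced ℂ (Sobolev d s) (L2 d) Sobolev.bessel

/-- The real-valued function `f` is a representative of `u ∈ H^s(ℝ^d)` (and lies in `L²`). -/
def Sobolev.IsRepresentedBy {d : ℕ} {s : ℝ} (u : Sobolev d s) (f : E d → ℝ) : Prop :=
  ∃ F : L2 d, (∀ᵐ x, F x = (f x : ℂ)) ∧ u.toDistribution = (F : 𝓢'(E d, ℂ))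

/-- The coefficient `c(z,x,τ) = c₀ + ∑ₗ cₗ(z,x) hₗ(τ)`. -/
def coeff {d N : ℕ} (c₀ : ℝ) (c : Fin N → ℝ → E d → ℝ) (h : Fin N → ℝ → ℝ)
    (τ z : ℝ) (x : E d) : ℝ :=
  c₀ + ∑ l, c l z x * h l τ

/-- The standing assumption on the coefficient, with symbol order `m` and regularity index `r`. -/
structure CoeffAssumption {d N : ℕ} (m r c₀ : ℝ) (c : Fin N → ℝ → E d → ℝ)
    (h : Fin N → ℝ → ℝ) : Prop where
  smooth_symbol : ∀ l, ContDiff ℝ ∞ (h l)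
  symbol_estimate : ∀ l (k : ℕ),
    iteratedDeriv k (h l) =O[Bornology.cobounded ℝ] fun τ : ℝ => |τ| ^ (m - k)
  symbol_lower_bound : ∃ η₀ : ℝ, 0 < η₀ ∧ ∀ l, ∀ᶠ τ in nhds (0 : ℝ), η₀ ≤ |h l τ|
  c₀_pos : 0 < c₀
  r_mem : r ∈ Ioo (0 : ℝ) 1
  /-- `cₗ ∈ C¹([0,∞), H^(r+1)(ℝ^d))`. -/
  lateral_regularity : ∀ l, ∃ γ : ℝ → Sobolev d (r + 1), ContDiffOn ℝ 1 γ (Ici 0) ∧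
    ∀ z, 0 ≤ z → (γ z).IsRepresentedBy (c l z)
  lower_bound : ∀ z, 0 ≤ z → ∀ τ, ∀ᵐ x, c₀ ≤ coeff c₀ c h τ z x

/-- `v ∈ L²(ℝ^d)` belongs to `H²(ℝ^d)`. -/
def MemH2 {d : ℕ} (v : L2 d) : Prop :=
  TemperedDistribution.MemSobolev 2 2 (v : 𝓢'(E d, ℂ))

/-- `div (a ∇v) = w` for `v, w ∈ L²(ℝ^d)`: the distributional derivatives `∂ⱼ v = gⱼ` and the
products `a gⱼ = qⱼ` are in `L²`, and `∑ⱼ ∂ⱼ qⱼ = w` in the sense of distributions. -/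
def IsDivGrad {d : ℕ} (a : E d → ℝ) (v w : L2 d) : Prop :=
  ∃ g q : Fin d → L2 d,
    (∀ j, ∂_{(EuclideanSpace.single j (1 : ℝ) : E d)} (v : 𝓢'(E d, ℂ)) = (g j : 𝓢'(E d, ℂ))) ∧
    (∀ j, ∀ᵐ x, q j x = (a x : ℂ) * g j x) ∧
    ∑ j, ∂_{(EuclideanSpace.single j (1 : ℝ) : E d)} (q j : 𝓢'(E d, ℂ)) = (w : 𝓢'(E d, ℂ))

/-- The graph of the unbounded operator `A v = div (a ∇v)` on `L²(ℝ^d)` with domain `H²(ℝ^d)`: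
`v` is in the domain, and `A v = w`. -/
def OpGraph {d : ℕ} (a : E d → ℝ) (v w : L2 d) : Prop :=
  MemH2 v ∧ IsDivGrad a v w

/-- `(U z₁ z₂)`, for `Z ≥ z₁ ≥ z₂ ≥ 0`, is an evolution system on `L²(ℝ^d)` for the family `i A(z)`,
where `A(z) v = div (a z ∇v)` has domain `H²(ℝ^d)`. The values of `U` at other arguments are
irrelevant. -/
structure IsEvolutionSystem {d : ℕ} (Z : ℝ) (a : ℝ → E d → ℝ) (U : ℝ → ℝ → L2 d →L[ℂ] L2 d) :
    Prop where
  strongly_continuous : ∀ v, ContinuousOn (fun p : ℝ × ℝ => U p.1 p.2 v)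
    {p | 0 ≤ p.2 ∧ p.2 ≤ p.1 ∧ p.1 ≤ Z}
  diag : ∀ z ∈ Icc 0 Z, U z z = ContinuousLinearMap.id ℂ (L2 d)
  contractive : ∀ z₁ z₂, 0 ≤ z₂ → z₂ ≤ z₁ → z₁ ≤ Z → ‖U z₁ z₂‖ ≤ 1
  comp : ∀ z₁ z₂ z₃, 0 ≤ z₃ → z₃ ≤ z₂ → z₂ ≤ z₁ → z₁ ≤ Z → (U z₁ z₂).comp (U z₂ z₃) = U z₁ z₃
  invariant : ∀ z₁ z₂, 0 ≤ z₂ → z₂ ≤ z₁ → z₁ ≤ Z → ∀ v, MemH2 v → MemH2 (U z₁ z₂ v)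
  contDiff_fst : ∀ v, MemH2 v → ∀ z₂ ∈ Icc 0 Z,
    ContDiffOn ℝ 1 (fun z₁ => U z₁ z₂ v) (Icc z₂ Z)
  contDiff_snd : ∀ v, MemH2 v → ∀ z₁ ∈ Icc 0 Z,
    ContDiffOn ℝ 1 (fun z₂ => U z₁ z₂ v) (Icc 0 z₁)
  /-- `∂_{z₁} U(z₁,z₂) v = i A(z₁) U(z₁,z₂) v`. -/
  deriv_fst : ∀ z₁ z₂, 0 ≤ z₂ → z₂ ≤ z₁ → z₁ ≤ Z → ∀ v, MemH2 v →
    ∃ w, OpGraph (a z₁) (U z₁ z₂ v) w ∧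
      HasDerivWithinAt (fun z => U z z₂ v) (Complex.I • w) (Icc z₂ Z) z₁
  /-- `∂_{z₂} U(z₁,z₂) v = - U(z₁,z₂) i A(z₂) v`. -/
  deriv_snd : ∀ z₁ z₂, 0 ≤ z₂ → z₂ ≤ z₁ → z₁ ≤ Z → ∀ v, MemH2 v →
    ∃ w, OpGraph (a z₂) v w ∧
      HasDerivWithinAt (fun z => U z₁ z v) (-(U z₁ z₂ (Complex.I • w))) (Icc 0 z₁) z₂

end Paraxial

end

/-! Put L(z) = 1 - A(z), so that iA(z) = i(1 - L(z)). Since the coefficient is real and at least c₀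
> 0, integration by parts makes L(z) symmetric with L(z) ≥ 1. Elliptic regularity gives it the same
domain H² for every z, with inverse R(z) bounded on L². The evolution is built only from the facts
collected in `ResolventFamily`: R(z) is symmetric and nonnegative with dense range, and L(z)R(s) - 1
is bounded by C|z - s|.

Existence is a Yosida approximation. The bounded operators Y_ε(z) = (R(z) + ε)⁻¹ = L(1 + εL)⁻¹
replace L(z). Then i(1 - Y_ε(z)) is skew and norm continuous in z, and ODE theory gives isometric
propagators (`exists_propagator`). Two estimates do not degenerate as ε → 0. Along a solution
‖Y_ε(z)u(z)‖ grows at most like exp(C|z - s|) (`norm_yosida_solution_le`), which stands in for an H²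
bound. Two approximate solutions with the same datum in H² differ by O(√(ε + δ)) (`norm_sub_sq_le`).
The propagators therefore converge strongly. The vectors Y_ε u converge weakly to w = Lu, and w
turns out to be norm continuous, so the limit is differentiable with the right derivative
(`ResolventFamily.exists_evolution`).

The elliptic part is carried out on L². The multipliers J^s with symbol (1 + |ξ|²)^(-s/2) identify
H^s with L², and the Leibniz rule turns div((c₀ + b)∇v) into (c₀ + b)Δv + ∇b·∇v with b ∈ H^(1+r).
Multiplication maps H^r × H^s into L² when r + s > d/2 (`lintegral_J_mul_J_le`). As d ≤ 2, this
holds for some s < 1, so ∇b·∇v is of lower order and interpolation absorbs it. This gives the H²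
bound `exists_apriori`, and the method of continuity, started at the constant coefficient c₀, makes
L(z) invertible (`IsNonneg.isUnit_ellOp`).

Uniqueness: z ↦ V(z₁,z)U(z,z₂)v has derivative zero for v ∈ H², and H² is dense. -/

noncomputable section
namespace Paraxial

/-! ### Propagators of norm-continuous families of bounded skew operators. -/

section Abstract

variable {H : Type*} [NormedAddCommGroup H] [InnerProductSpace ℂ H]

theorem hasDerivWithinAt_norm_sq {u : ℝ → H} {u' : H} {s : Set ℝ} {z : ℝ}
    (hu : HasDerivWithinAt u u' s z) :
    HasDerivWithinAt (fun t => ‖u t‖ ^ 2) (2 * (inner ℂ (u z) u').re) s z := by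
  let _ : InnerProductSpace ℝ H := InnerProductSpace.rclikeToReal ℂ H
  simpa using! hu.norm_sq

/-- The derivative of ‖u‖² is 2 Re⟨u, A u⟩ = 0. Linearity of A is not required, so the lemma also
serves the truncated vector field below. -/
theorem norm_eq_of_skew {A : ℝ → H → H} (hA : ∀ z x, (inner ℂ x (A z x)).re = 0) {u : ℝ → H}
    {a b : ℝ} (hu : ∀ z ∈ Icc a b, HasDerivWithinAt u (A z (u z)) (Icc a b) z) :
    ∀ z ∈ Icc a b, ∀ s ∈ Icc a b, ‖u z‖ = ‖u s‖ := by
  have h : ∀ z ∈ Icc a b, ‖u z‖ ^ 2 = ‖u a‖ ^ 2 := by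
    refine constant_of_has_deriv_right_zero (f := fun t => ‖u t‖ ^ 2) ?_ ?_
    · exact fun z hz => ((hu z hz).continuousWithinAt.norm.pow 2)
    · intro z hz
      have := hasDerivWithinAt_norm_sq (hu z (Ico_subset_Icc_self hz))
      rw [hA, mul_zero] at this
      exact this.mono_of_mem_nhdsWithin (Icc_mem_nhdsGE_of_mem hz)
  intro z hz s hs
  have := (h z hz).trans (h s hs).symm
  exact (pow_left_inj₀ (norm_nonneg _) (norm_nonneg _) two_ne_zero).mp this

theorem norm_smul_inv_one_add_norm_sub_le (x y : H) :
    ‖(1 + ‖x‖)⁻¹ • x - (1 + ‖y‖)⁻¹ • y‖ ≤ 2 * ‖x - y‖ := by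
  have hx : 0 ≤ ‖x‖ := norm_nonneg x
  have hy : 0 ≤ ‖y‖ := norm_nonneg y
  have e : (1 + ‖x‖)⁻¹ • x - (1 + ‖y‖)⁻¹ • y =
      (1 + ‖x‖)⁻¹ • (x - y) + ((1 + ‖x‖)⁻¹ - (1 + ‖y‖)⁻¹) • y := by module
  rw [e]
  have h1 : ‖(1 + ‖x‖)⁻¹ • (x - y)‖ ≤ ‖x - y‖ := by
    rw [norm_smul, Real.norm_of_nonneg (by positivity)]
    exact mul_le_of_le_one_left (norm_nonneg _) (inv_le_one_of_one_le₀ (by linarith))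
  have h2 : ‖((1 + ‖x‖)⁻¹ - (1 + ‖y‖)⁻¹) • y‖ ≤ ‖x - y‖ := by
    have e2 : (1 + ‖x‖)⁻¹ - (1 + ‖y‖)⁻¹ = (‖y‖ - ‖x‖) * ((1 + ‖x‖)⁻¹ * (1 + ‖y‖)⁻¹) := by
      field_simp; ring
    rw [norm_smul, e2, norm_mul, Real.norm_eq_abs, Real.norm_of_nonneg (by positivity), mul_assoc]
    have h3 : |‖y‖ - ‖x‖| ≤ ‖x - y‖ := by
      rw [norm_sub_rev]; exact abs_norm_sub_norm_le y x
    have h4 : (1 + ‖x‖)⁻¹ * (1 + ‖y‖)⁻¹ * ‖y‖ ≤ 1 := by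
      rw [mul_assoc]
      refine mul_le_one₀ (inv_le_one_of_one_le₀ (by linarith)) (by positivity) ?_
      rw [inv_mul_le_iff₀ (by positivity)]; linarith
    exact (mul_le_of_le_one_right (abs_nonneg _) h4).trans h3
  linarith [norm_add_le ((1 + ‖x‖)⁻¹ • (x - y)) (((1 + ‖x‖)⁻¹ - (1 + ‖y‖)⁻¹) • y)]

/-- Picard–Lindelöf covers the whole interval at once if the vector field is globally bounded, so A
z y is replaced by A z (k y / (1 + ‖y‖)). The new field is still skew, so its solution keeps the
norm ‖x‖, and for k = 1 + ‖x‖ the factor k / (1 + ‖y‖) equals 1 along it. -/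
theorem exists_solution_Icc [CompleteSpace H] {A : ℝ → H →L[ℂ] H} (hAc : Continuous A)
    (hA : ∀ z x, (inner ℂ x (A z x)).re = 0) (s : ℝ) (x : H) {T : ℝ} (hT : 0 ≤ T) :
    ∃ u : ℝ → H, u s = x ∧ ∀ z ∈ Icc (s - T) (s + T),
      HasDerivWithinAt u (A z (u z)) (Icc (s - T) (s + T)) z := by
  obtain ⟨M, hM⟩ := (isCompact_Icc (a := s - T) (b := s + T)).exists_bound_of_continuousOn
    hAc.continuousOn
  have hs : s ∈ Icc (s - T) (s + T) := ⟨by linarith, by linarith⟩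
  have hM0 : 0 ≤ M := (norm_nonneg _).trans (hM s hs)
  set k : ℝ := 1 + ‖x‖ with hk
  have hk0 : 0 < k := by positivity
  let f : ℝ → H → H := fun z y => A z (k • (1 + ‖y‖)⁻¹ • y)
  have hb : ∀ y : H, ‖(1 + ‖y‖)⁻¹ • y‖ ≤ 1 := fun y => by
    rw [norm_smul, Real.norm_of_nonneg (by positivity), inv_mul_le_iff₀ (by positivity)]
    linarith
  have hf : IsPicardLindelof f (⟨s, hs⟩ : Icc (s - T) (s + T)) x
      (M * k * T).toNNReal 0 (M * k).toNNReal (M * k * 2).toNNReal := by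
    have e1 := Real.coe_toNNReal (M * k * T) (by positivity)
    have e2 := Real.coe_toNNReal (M * k) (by positivity)
    have e3 := Real.coe_toNNReal (M * k * 2) (by positivity)
    refine ⟨?_, ?_, ?_, ?_⟩
    · intro z hz
      refine LipschitzOnWith.of_dist_le_mul fun y _ y' _ => ?_
      simp only [f, dist_eq_norm, e3, ← map_sub, ← smul_sub]
      calc _ ≤ M * ‖k • ((1 + ‖y‖)⁻¹ • y - (1 + ‖y'‖)⁻¹ • y')‖ :=
            (A z).le_of_opNorm_le (hM z hz) _
        _ ≤ M * (k * (2 * ‖y - y'‖)) := by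
            rw [norm_smul, Real.norm_of_nonneg hk0.le]
            gcongr
            exact norm_smul_inv_one_add_norm_sub_le y y'
        _ = _ := by ring
    · intro y _
      exact (hAc.clm_apply continuous_const).continuousOn
    · intro z hz y _
      calc _ ≤ M * ‖k • (1 + ‖y‖)⁻¹ • y‖ := (A z).le_of_opNorm_le (hM z hz) _
        _ ≤ M * (k * 1) := by
            rw [norm_smul, Real.norm_of_nonneg hk0.le]
            gcongr
            exact hb y
        _ = _ := by rw [e2, mul_one]
    · simp [e1, e2]
  obtain ⟨u, hus, hu⟩ := hf.exists_eq_forall_mem_Icc_hasDerivWithinAt₀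
  have hn := norm_eq_of_skew (A := f) (fun z y => ?_) hu
  · refine ⟨u, hus, fun z hz => ?_⟩
    have h := hu z hz
    have e : f z (u z) = A z (u z) := by
      have : ‖u z‖ = ‖x‖ := by rw [hn z hz s hs]; exact congrArg _ hus
      simp only [f, this, ← hk, smul_smul, mul_inv_cancel₀ hk0.ne', one_smul]
    rwa [e] at h
  · simp only [f, smul_smul]
    rw [← Complex.coe_smul, map_smul, inner_smul_right, Complex.re_ofReal_mul, hA, mul_zero]

/-- The solutions on the intervals [s - n, s + n] agree where they overlap, because the norm of
their difference is conserved and vanishes at s. -/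
theorem exists_solution [CompleteSpace H] {A : ℝ → H →L[ℂ] H} (hAc : Continuous A)
    (hA : ∀ z x, (inner ℂ x (A z x)).re = 0) (s : ℝ) (x : H) :
    ∃ u : ℝ → H, u s = x ∧ ∀ z, HasDerivAt u (A z (u z)) z := by
  choose v hvs hv using fun n : ℕ => exists_solution_Icc hAc hA s x (Nat.cast_nonneg (α := ℝ) n)
  have key : ∀ n m : ℕ, n ≤ m → ∀ z ∈ Icc (s - n) (s + n), v m z = v n z := by
    intro n m hnm z hz
    have hnm' : (n : ℝ) ≤ m := by exact_mod_cast hnm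
    have hsub : Icc (s - n) (s + n) ⊆ Icc (s - m) (s + m) :=
      Icc_subset_Icc (by linarith) (by linarith)
    have hd : ∀ z ∈ Icc (s - n) (s + n), HasDerivWithinAt (fun z => v m z - v n z)
        (A z (v m z - v n z)) (Icc (s - n) (s + n)) z := fun z hz => by
      rw [map_sub]
      exact ((hv m z (hsub hz)).mono hsub).sub (hv n z hz)
    have hn : (0 : ℝ) ≤ n := Nat.cast_nonneg n
    have := norm_eq_of_skew (A := fun z => A z) hA hd z hz s ⟨by linarith, by linarith⟩
    rw [hvs, hvs, sub_self, norm_zero, norm_eq_zero, sub_eq_zero] at this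
    exact this
  refine ⟨fun z => v ⌈|z - s|⌉₊ z, by simp [hvs], fun z => ?_⟩
  have hmem : ∀ y, y ∈ Icc (s - (⌈|y - s|⌉₊ : ℝ)) (s + (⌈|y - s|⌉₊ : ℝ)) := fun y => by
    have := abs_le.mp (Nat.le_ceil |y - s|)
    constructor <;> linarith
  -- The extra 1 puts z in the interior, where the one-sided derivative becomes a two-sided one.
  set n := ⌈|z - s|⌉₊ + 1 with hn
  have hz : z ∈ Ioo (s - n) (s + n) := by
    have := hmem z
    rw [hn]; push_cast
    constructor <;> linarith [this.1, this.2]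
  have hev : ∀ y ∈ Icc (s - n) (s + n), v ⌈|y - s|⌉₊ y = v n y := by
    intro y hy
    refine (key _ n ?_ y (hmem y)).symm
    rw [Nat.ceil_le, abs_le]
    constructor <;> linarith [hy.1, hy.2]
  have h := (hv n z (Ioo_subset_Icc_self hz)).hasDerivAt (Icc_mem_nhds hz.1 hz.2)
  show HasDerivAt _ (A z (v ⌈|z - s|⌉₊ z)) z
  rw [hev z (Ioo_subset_Icc_self hz)]
  refine h.congr_of_eventuallyEq ?_
  filter_upwards [Icc_mem_nhds hz.1 hz.2] with y hy using hev y hy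

theorem norm_eq_of_skew' {A : ℝ → H → H} (hA : ∀ z x, (inner ℂ x (A z x)).re = 0) {u : ℝ → H}
    (hu : ∀ z, HasDerivAt u (A z (u z)) z) (z s : ℝ) : ‖u z‖ = ‖u s‖ :=
  norm_eq_of_skew hA (a := min z s) (b := max z s) (fun y _ => (hu y).hasDerivWithinAt)
    z ⟨min_le_left _ _, le_max_left _ _⟩ s ⟨min_le_right _ _, le_max_right _ _⟩

/-- The propagator of `u' = A(z) u` with a norm continuous family of skew operators. -/
theorem exists_propagator [CompleteSpace H] {A : ℝ → H →L[ℂ] H} (hAc : Continuous A)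
    (hA : ∀ z x, (inner ℂ x (A z x)).re = 0) :
    ∃ U : ℝ → ℝ → H →L[ℂ] H, (∀ s, U s s = ContinuousLinearMap.id ℂ H) ∧
      (∀ z s x, ‖U z s x‖ = ‖x‖) ∧ (∀ z y s x, U z y (U y s x) = U z s x) ∧
      ∀ s x z, HasDerivAt (fun z => U z s x) (A z (U z s x)) z := by
  choose v hvs hv using fun s x => exists_solution hAc hA s x
  have uniq : ∀ (u w : ℝ → H) (s : ℝ), (∀ z, HasDerivAt u (A z (u z)) z) →
      (∀ z, HasDerivAt w (A z (w z)) z) → u s = w s → ∀ z, u z = w z := by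
    intro u w s hu hw h z
    have := norm_eq_of_skew' (A := fun z => A z) (u := fun z => u z - w z) hA (fun z => by
      rw [map_sub]; exact (hu z).sub (hw z)) z s
    rwa [h, sub_self, norm_zero, norm_eq_zero, sub_eq_zero] at this
  have hnorm : ∀ s x z, ‖v s x z‖ = ‖x‖ := fun s x z => by
    rw [norm_eq_of_skew' (A := fun z => A z) hA (hv s x) z s, hvs]
  let U : ℝ → ℝ → H →L[ℂ] H := fun z s => LinearMap.mkContinuous
    { toFun := fun x => v s x z
      map_add' := fun x y => uniq _ (fun z => v s x z + v s y z) s (hv s _)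
        (fun z => by rw [map_add]; exact (hv s x z).add (hv s y z)) (by simp [hvs]) z
      map_smul' := fun a x => uniq _ (fun z => a • v s x z) s (hv s _)
        (fun z => by rw [map_smul]; exact (hv s x z).const_smul a) (by simp [hvs]) z } 1
    (fun x => by simp [hnorm])
  refine ⟨U, fun s => ?_, fun z s x => hnorm s x z, fun z y s x => ?_, fun s x z => hv s x z⟩
  · ext x; exact hvs s x
  · exact uniq _ _ y (hv y _) (hv s x) (hvs y _) z

end Abstract
end Paraxial
end


noncomputable section
namespace Paraxial

/-! ### Yosida approximation and its uniform estimates. -/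

section Yosida

variable {H : Type*} [NormedAddCommGroup H] [InnerProductSpace ℂ H]

/-- The inverses `R z = L(z)⁻¹` of a family of nonnegative self-adjoint operators `L(z)` with a
common domain, which depends on `z` in a Lipschitz way. -/
structure ResolventFamily (R : ℝ → H →L[ℂ] H) (C : ℝ) : Prop where
  const_nonneg : 0 ≤ C
  symm : ∀ z x y, inner ℂ (R z x) y = inner ℂ x (R z y)
  nonneg : ∀ z x, 0 ≤ (inner ℂ x (R z x)).re
  dense : ∀ z, DenseRange (R z)
  compare : ∀ z s, ∃ Q : H →L[ℂ] H, (∀ x, R s x - R z x = R z (Q x)) ∧ ‖Q‖ ≤ C * |z - s|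

theorem re_inner_I_smul {x y : H} (h : inner ℂ x y = inner ℂ y x) :
    (inner ℂ x (Complex.I • y)).re = 0 := by
  have h' : (inner ℂ x y : ℂ).im = 0 := by
    rw [← Complex.conj_eq_iff_im, inner_conj_symm, h]
  rw [inner_smul_right, Complex.mul_re, h', Complex.I_re]
  ring

/-- Grönwall for a function that need not be differentiable: at each s it is touched from above by
(1 + C|z - s|)² g(z), whose right derivative at s is 2C f(s), and this controls the right slopes of
f. -/
theorem le_mul_exp_of_local_bound_right {f : ℝ → ℝ} {C : ℝ} (hf : Continuous f)
    (h : ∀ s, ∃ g : ℝ → ℝ, HasDerivAt g 0 s ∧ g s = f s ∧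
      ∀ z, f z ≤ (1 + C * |z - s|) ^ 2 * g z) {s z : ℝ} (hsz : s ≤ z) :
    f z ≤ f s * Real.exp (2 * C * |z - s|) := by
  have := le_gronwallBound_of_liminf_deriv_right_le (f := f) (f' := fun x => 2 * C * f x)
    (δ := f s) (K := 2 * C) (ε := 0) (a := s) (b := z) hf.continuousOn ?_ le_rfl
    (fun x _ => by simp) z ⟨hsz, le_rfl⟩
  · rwa [gronwallBound_ε0, ← abs_of_nonneg (sub_nonneg.2 hsz)] at this
  intro x _ r hr
  obtain ⟨g, hg, hgx, hfg⟩ := h x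
  have hG : HasDerivAt (fun z => (1 + C * (z - x)) ^ 2 * g z) (2 * C * f x) x := by
    have h1 : HasDerivAt (fun z => 1 + C * (z - x)) C x := by
      simpa using (((hasDerivAt_id x).sub_const x).const_mul C).const_add 1
    have := (h1.pow 2).mul hg
    simp only [hgx] at this
    convert! this using 1
    simp
  refine ((hG.hasDerivWithinAt (s := Ici x)).liminf_right_slope_le hr).mp ?_
  filter_upwards [self_mem_nhdsWithin] with y hy hlt
  refine lt_of_le_of_lt ?_ hlt
  have hy' : 0 < y - x := sub_pos.2 hy
  rw [slope_def_field, div_eq_inv_mul]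
  have := hfg y
  rw [abs_of_pos hy'] at this
  simp only [sub_self, mul_zero, add_zero, one_pow, one_mul, hgx]
  gcongr

theorem le_mul_exp_of_local_bound {f : ℝ → ℝ} {C : ℝ} (hf : Continuous f)
    (h : ∀ s, ∃ g : ℝ → ℝ, HasDerivAt g 0 s ∧ g s = f s ∧
      ∀ z, f z ≤ (1 + C * |z - s|) ^ 2 * g z) (s z : ℝ) :
    f z ≤ f s * Real.exp (2 * C * |z - s|) := by
  rcases le_total s z with hsz | hsz
  · exact le_mul_exp_of_local_bound_right hf h hsz
  · have := le_mul_exp_of_local_bound_right (f := fun x => f (-x)) (C := C) (s := -s) (z := -z)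
      (by fun_prop) (fun x => ?_) (neg_le_neg hsz)
    · simpa [abs_sub_comm, neg_add_eq_sub] using this
    · obtain ⟨g, hg, hgx, hfg⟩ := h (-x)
      refine ⟨fun y => g (-y), ?_, hgx, fun y => ?_⟩
      · simpa using! HasDerivAt.scomp x hg (hasDerivAt_neg x)
      · have := hfg (-y)
        rwa [show -y - -x = -(y - x) by ring, abs_neg] at this

variable {R : ℝ → H →L[ℂ] H} {C : ℝ}

namespace ResolventFamily

theorem continuous (hR : ResolventFamily R C) : Continuous R := by
  rw [continuous_iff_continuousAt]
  intro z
  rw [ContinuousAt, tendsto_iff_norm_sub_tendsto_zero]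
  refine squeeze_zero (g := fun s => ‖R z‖ * (C * |z - s|)) (fun _ => norm_nonneg _) (fun s => ?_) ?_
  · obtain ⟨Q, hQ, hQn⟩ := hR.compare z s
    have : R s - R z = (R z).comp Q := by ext x; exact hQ x
    rw [this]
    exact (ContinuousLinearMap.opNorm_comp_le _ _).trans (by gcongr)
  · have : Continuous fun s => ‖R z‖ * (C * |z - s|) := by fun_prop
    simpa using this.tendsto z

theorem injective [CompleteSpace H] (hR : ResolventFamily R C) (z : ℝ) : Function.Injective (R z) := by
  rw [injective_iff_map_eq_zero]
  intro x hx
  refine (hR.dense z).eq_zero_of_inner_left (𝕜 := ℂ) fun y => ?_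
  rw [← hR.symm, hx, inner_zero_left]

/-- The bounded approximation `(R z + ε)⁻¹` of `L(z)`. -/
def _root_.Paraxial.yosida (R : ℝ → H →L[ℂ] H) (ε z : ℝ) : H →L[ℂ] H :=
  Ring.inverse (R z + (ε : ℂ) • (1 : H →L[ℂ] H))

/-- Expanding the square, the cross term is 2ε Re⟨x, R x⟩ ≥ 0. Equivalently, R(R + ε)⁻¹ is a
contraction for every ε > 0. -/
theorem norm_map_le (hR : ResolventFamily R C) {ε : ℝ} (hε : 0 < ε) (z : ℝ) (x : H) :
    ‖R z x‖ ≤ ‖R z x + (ε : ℂ) • x‖ := by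
  have h : ‖R z x + (ε : ℂ) • x‖ ^ 2 =
      ‖R z x‖ ^ 2 + 2 * (ε * (inner ℂ x (R z x)).re) + ‖(ε : ℂ) • x‖ ^ 2 := by
    rw [norm_add_sq (𝕜 := ℂ), inner_smul_right, ← hR.symm]
    simp
  have h1 := hR.nonneg z x
  refine abs_le_of_sq_le_sq' ?_ (norm_nonneg _) |>.2
  rw [h]
  nlinarith [mul_nonneg hε.le h1, sq_nonneg ‖(ε : ℂ) • x‖]

variable [CompleteSpace H] {ε : ℝ}

theorem isUnit_add (hR : ResolventFamily R C) (hε : 0 < ε) (z : ℝ) :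
    IsUnit (R z + (ε : ℂ) • (1 : H →L[ℂ] H)) := by
  refine ContinuousLinearMap.isUnit_of_forall_le_norm_inner_map _ (c := ⟨ε, hε.le⟩) hε fun x => ?_
  refine le_trans ?_ (Complex.re_le_norm _)
  have h1 := hR.nonneg z x
  rw [← hR.symm] at h1
  have h2 : (inner ℂ ((ε : ℂ) • x) x).re = ‖x‖ ^ 2 * ε := by
    rw [inner_smul_left, inner_self_eq_norm_sq_to_K]
    simp [← Complex.ofReal_pow, mul_comm]
  simp only [add_apply, smul_apply, one_apply_eq_self, inner_add_left, Complex.add_re, h2]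
  exact le_add_of_nonneg_left h1

theorem add_yosida (hR : ResolventFamily R C) (hε : 0 < ε) (z : ℝ) (x : H) :
    R z (yosida R ε z x) + (ε : ℂ) • yosida R ε z x = x := by
  simpa using! congrArg (fun T : H →L[ℂ] H => T x) (Ring.mul_inverse_cancel _ (hR.isUnit_add hε z))

theorem yosida_add (hR : ResolventFamily R C) (hε : 0 < ε) (z : ℝ) (x : H) :
    yosida R ε z (R z x + (ε : ℂ) • x) = x := by
  simpa using! congrArg (fun T : H →L[ℂ] H => T x) (Ring.inverse_mul_cancel _ (hR.isUnit_add hε z))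

theorem yosida_comm (hR : ResolventFamily R C) (hε : 0 < ε) (z : ℝ) (x : H) :
    yosida R ε z (R z x) = R z (yosida R ε z x) := by
  have h1 := hR.add_yosida hε z x
  have h2 := hR.yosida_add hε z x
  rw [map_add, map_smul] at h2
  exact add_right_cancel (h2.trans h1.symm)

theorem yosida_symm (hR : ResolventFamily R C) (hε : 0 < ε) (z : ℝ) (x y : H) :
    inner ℂ (yosida R ε z x) y = inner ℂ x (yosida R ε z y) := by
  conv_lhs => rw [← hR.add_yosida hε z y]
  conv_rhs => rw [← hR.add_yosida hε z x]
  simp only [inner_add_left, inner_add_right, hR.symm, inner_smul_left, inner_smul_right,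
    Complex.conj_ofReal]

theorem norm_yosida_map_le (hR : ResolventFamily R C) (hε : 0 < ε) (z : ℝ) (x : H) :
    ‖yosida R ε z (R z x)‖ ≤ ‖x‖ := by
  rw [hR.yosida_comm hε]
  simpa only [hR.add_yosida hε] using hR.norm_map_le hε z (yosida R ε z x)

theorem continuous_yosida (hR : ResolventFamily R C) (hε : 0 < ε) : Continuous (yosida R ε) := by
  rw [continuous_iff_continuousAt]
  intro z
  obtain ⟨u, hu⟩ := hR.isUnit_add hε z
  have := NormedRing.inverse_continuousAt u
  rw [hu] at this
  exact ContinuousAt.comp (f := fun z => R z + (ε : ℂ) • (1 : H →L[ℂ] H)) this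
    (hR.continuous.add continuous_const).continuousAt

/-- Resolvent identity: Y(z) - Y(s) = Y(z)(R(s) - R(z))Y(s) = (Y(z)R(z)) Q Y(s), where Y(z)R(z) is a
contraction. The bound is thus independent of ε. -/
theorem norm_yosida_le (hR : ResolventFamily R C) (hε : 0 < ε) (s z : ℝ) (x : H) :
    ‖yosida R ε z x‖ ≤ (1 + C * |z - s|) * ‖yosida R ε s x‖ := by
  obtain ⟨Q, hQ, hQn⟩ := hR.compare z s
  set y := yosida R ε s x with hy
  have e : yosida R ε z x = y + yosida R ε z (R z (Q y)) := by
    have h1 := hR.add_yosida hε s x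
    have h2 := hR.yosida_add hε z y
    rw [← hQ, map_sub, ← h1, ← hy, map_add]
    rw [map_add] at h2
    nth_rewrite 3 [← h2]
    abel
  rw [e]
  have h3 : ‖yosida R ε z (R z (Q y))‖ ≤ C * |z - s| * ‖y‖ :=
    (hR.norm_yosida_map_le hε z _).trans (Q.le_of_opNorm_le hQn y)
  linarith [norm_add_le y (yosida R ε z (R z (Q y)))]

theorem re_inner_generator (hR : ResolventFamily R C) (hε : 0 < ε) (z : ℝ) (x : H) :
    (inner ℂ x (Complex.I • (x - yosida R ε z x))).re = 0 := by
  refine re_inner_I_smul ?_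
  rw [inner_sub_right, inner_sub_left, hR.yosida_symm hε]

/-- Freeze the index at x. Since Y(x) commutes with the generator i(1 - Y(x)), which is skew, y ↦
‖Y(x)u(y)‖² has zero derivative at y = x. Returning to the moving index costs the factor (1 + C|y -
x|)², and the Grönwall lemma above applies. -/
theorem norm_yosida_solution_le (hR : ResolventFamily R C) (hε : 0 < ε) {u : ℝ → H}
    (hu : ∀ z, HasDerivAt u (Complex.I • (u z - yosida R ε z (u z))) z) (s z : ℝ) :
    ‖yosida R ε z (u z)‖ ≤ ‖yosida R ε s (u s)‖ * Real.exp (C * |z - s|) := by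
  have huc : Continuous u := continuous_iff_continuousAt.2 fun z => (hu z).continuousAt
  have h := le_mul_exp_of_local_bound (f := fun z => ‖yosida R ε z (u z)‖ ^ 2) (C := C)
    (((hR.continuous_yosida hε).clm_apply huc).norm.pow 2) (fun x => ?_) s z
  · have e : Real.exp (2 * C * |z - s|) = Real.exp (C * |z - s|) ^ 2 := by
      rw [← Real.exp_nat_mul]; push_cast; ring_nf
    rw [e, ← mul_pow] at h
    exact abs_le_of_sq_le_sq' h (by positivity) |>.2
  · refine ⟨fun y => ‖yosida R ε x (u y)‖ ^ 2, ?_, rfl, fun y => ?_⟩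
    · have h1 : HasDerivAt (fun y => yosida R ε x (u y))
          (yosida R ε x (Complex.I • (u x - yosida R ε x (u x)))) x :=
        ((yosida R ε x).restrictScalars ℝ).hasFDerivAt.comp_hasDerivAt x (hu x)
      rw [← hasDerivWithinAt_univ] at h1 ⊢
      have h2 := hasDerivWithinAt_norm_sq h1
      rwa [map_smul, map_sub, hR.re_inner_generator hε, mul_zero] at h2
    · rw [← mul_pow]
      gcongr
      exact hR.norm_yosida_le hε x y (u y)

/-- With p = Y_ε u and q = Y_δ v, one has u - v = R(p - q) + (εp - δq). In the derivative of ‖u -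
v‖² the pairing of R(p - q) with i(p - q) has zero real part by symmetry of R, which leaves at most
2 · (ε + δ)M · 2M. -/
theorem norm_sub_sq_le {ε δ : ℝ} (hR : ResolventFamily R C) (hε : 0 < ε) (hδ : 0 < δ) {u v : ℝ → H}
    (hu : ∀ z, HasDerivAt u (Complex.I • (u z - yosida R ε z (u z))) z)
    (hv : ∀ z, HasDerivAt v (Complex.I • (v z - yosida R δ z (v z))) z) {s : ℝ} (huv : u s = v s)
    {M T : ℝ} (hMu : ∀ z, |z - s| ≤ T → ‖yosida R ε z (u z)‖ ≤ M)
    (hMv : ∀ z, |z - s| ≤ T → ‖yosida R δ z (v z)‖ ≤ M) {z : ℝ} (hz : |z - s| ≤ T) :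
    ‖u z - v z‖ ^ 2 ≤ 4 * (ε + δ) * M ^ 2 * |z - s| := by
  set f : ℝ → ℝ := fun z => ‖u z - v z‖ ^ 2
  have hd : ∀ z, HasDerivAt f (2 * (inner ℂ (u z - v z)
      (Complex.I • (u z - yosida R ε z (u z)) - Complex.I • (v z - yosida R δ z (v z)))).re) z := by
    intro z
    rw [← hasDerivWithinAt_univ]
    exact hasDerivWithinAt_norm_sq ((hu z).sub (hv z)).hasDerivWithinAt
  have hb : ∀ z ∈ Metric.closedBall s T, ‖2 * (inner ℂ (u z - v z)
      (Complex.I • (u z - yosida R ε z (u z)) - Complex.I • (v z - yosida R δ z (v z)))).re‖ ≤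
      4 * (ε + δ) * M ^ 2 := by
    intro z hz
    rw [Metric.mem_closedBall, Real.dist_eq] at hz
    have hM1 := hMu z hz
    have hM2 := hMv z hz
    set p := yosida R ε z (u z)
    set q := yosida R δ z (v z)
    have hM : 0 ≤ M := (norm_nonneg p).trans hM1
    have e1 : u z - v z = R z (p - q) + ((ε : ℂ) • p - (δ : ℂ) • q) := by
      rw [← hR.add_yosida hε z (u z), ← hR.add_yosida hδ z (v z), map_sub]
      show R z p + _ • p - (R z q + _ • q) = _
      abel
    have e2 : Complex.I • (u z - p) - Complex.I • (v z - q) =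
        Complex.I • (u z - v z) - Complex.I • (p - q) := by
      module
    have i1 : ∀ x : H, (inner ℂ x (Complex.I • x)).re = 0 := fun x => re_inner_I_smul rfl
    have i2 : (inner ℂ (R z (p - q)) (Complex.I • (p - q))).re = 0 :=
      re_inner_I_smul (hR.symm _ _ _)
    have e3 : (inner ℂ (u z - v z) (Complex.I • (u z - v z) - Complex.I • (p - q))).re =
        -(inner ℂ ((ε : ℂ) • p - (δ : ℂ) • q) (Complex.I • (p - q))).re := by
      rw [inner_sub_right, Complex.sub_re, i1]
      nth_rewrite 1 [e1]
      rw [inner_add_left, Complex.add_re, i2]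
      ring
    rw [e2, e3, norm_mul, norm_neg, Real.norm_eq_abs, Real.norm_eq_abs, abs_two]
    have n1 : ‖(ε : ℂ) • p - (δ : ℂ) • q‖ ≤ (ε + δ) * M := by
      refine (norm_sub_le _ _).trans ?_
      rw [norm_smul, norm_smul, Complex.norm_real, Complex.norm_real, Real.norm_of_nonneg hε.le,
        Real.norm_of_nonneg hδ.le, add_mul]
      gcongr
    have n2 : ‖Complex.I • (p - q)‖ ≤ 2 * M := by
      rw [norm_smul, Complex.norm_I, one_mul]
      linarith [norm_sub_le p q]
    have n3 := (Complex.abs_re_le_norm _).trans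
      (norm_inner_le_norm (𝕜 := ℂ) ((ε : ℂ) • p - (δ : ℂ) • q) (Complex.I • (p - q)))
    have n4 : ‖(ε : ℂ) • p - (δ : ℂ) • q‖ * ‖Complex.I • (p - q)‖ ≤ (ε + δ) * M * (2 * M) := by
      gcongr
    nlinarith
  have h0 : 0 ≤ T := (abs_nonneg _).trans hz
  have := (convex_closedBall s T).norm_image_sub_le_of_norm_hasDerivWithin_le
    (fun z _ => (hd z).hasDerivWithinAt) hb (Metric.mem_closedBall_self h0)
    (y := z) (by rwa [Metric.mem_closedBall, Real.dist_eq])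
  have e : f s = 0 := by simp [f, huv]
  rw [e, sub_zero, Real.norm_eq_abs, Real.norm_eq_abs, abs_of_nonneg (sq_nonneg _)] at this
  exact this

end ResolventFamily
end Yosida
end Paraxial
end


noncomputable section
namespace Paraxial

open Filter Topology

/-! ### Strong and weak limits in Hilbert space. -/

section Limits

variable {H : Type*} [NormedAddCommGroup H] [InnerProductSpace ℂ H]

theorem exists_strong_limit {E F G : Type*} [NormedAddCommGroup E] [NormedSpace ℂ E]
    [NormedAddCommGroup F] [NormedSpace ℂ F] [CompleteSpace F] {T : ℕ → E →L[ℂ] F} {M : ℝ}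
    (hM : 0 ≤ M) (hT : ∀ n x, ‖T n x‖ ≤ M * ‖x‖) {g : G → E} (hg : DenseRange g)
    (hc : ∀ y, CauchySeq fun n => T n (g y)) :
    ∃ S : E →L[ℂ] F, (∀ x, Tendsto (fun n => T n x) atTop (𝓝 (S x))) ∧ ∀ x, ‖S x‖ ≤ M * ‖x‖ := by
  have hc' : ∀ x, CauchySeq fun n => T n x := by
    intro x
    rw [Metric.cauchySeq_iff]
    intro δ hδ
    obtain ⟨y, hy⟩ := hg.exists_dist_lt x (ε := δ / (3 * (M + 1))) (by positivity)
    obtain ⟨N, hN⟩ := Metric.cauchySeq_iff.1 (hc y) (δ / 3) (by positivity)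
    have hxy : ∀ n, dist (T n x) (T n (g y)) < δ / 3 := fun n => by
      rw [dist_eq_norm, ← map_sub]
      rw [dist_eq_norm, lt_div_iff₀ (by positivity)] at hy
      nlinarith [hT n (x - g y), norm_nonneg (x - g y)]
    refine ⟨N, fun m hm n hn => ?_⟩
    have h1 := hN m hm n hn
    have h2 := hxy n
    rw [dist_comm] at h2
    linarith [dist_triangle4 (T m x) (T m (g y)) (T n (g y)) (T n x), hxy m]
  choose S hS using fun x => cauchySeq_tendsto_of_complete (hc' x)
  have hb : ∀ x, ‖S x‖ ≤ M * ‖x‖ := fun x => le_of_tendsto' (hS x).norm fun n => hT n x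
  refine ⟨LinearMap.mkContinuous
    { toFun := S
      map_add' := fun x y => tendsto_nhds_unique (hS (x + y)) (by simpa using (hS x).add (hS y))
      map_smul' := fun a x => tendsto_nhds_unique (hS (a • x)) (by simpa using (hS x).const_smul a) }
    M hb, hS, hb⟩

/-- Symmetry gives ⟨w n, T y⟩ = ⟨T (w n), y⟩, so the bounded functionals ⟨w n, ·⟩ converge on the
dense range of T, and Riesz represents their limit. The full sequence converges weakly without
passing to a subsequence. -/
theorem exists_weak_limit [CompleteSpace H] {T : H →L[ℂ] H}
    (hT : ∀ x y, inner ℂ (T x) y = inner ℂ x (T y)) (hd : DenseRange T) {w : ℕ → H} {M : ℝ}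
    (hw : ∀ n, ‖w n‖ ≤ M) {u : H} (hu : Tendsto (fun n => T (w n)) atTop (𝓝 u)) :
    ∃ v, T v = u ∧ ‖v‖ ≤ M ∧ ∀ φ, Tendsto (fun n => inner ℂ φ (w n)) atTop (𝓝 (inner ℂ φ v)) := by
  have hM : 0 ≤ M := (norm_nonneg _).trans (hw 0)
  obtain ⟨S, hS, hSM⟩ := exists_strong_limit (T := fun n => innerSL ℂ (w n)) hM
    (fun n x => (norm_inner_le_norm _ _).trans (by gcongr; exact hw n)) hd
    (fun y => by
      have : Tendsto (fun n => inner ℂ (T (w n)) y) atTop (𝓝 (inner ℂ u y)) :=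
        hu.inner tendsto_const_nhds
      simp only [innerSL_apply_apply, ← hT]
      exact this.cauchySeq)
  set v := (InnerProductSpace.toDual ℂ H).symm S with hv
  have hvS : ∀ x, inner ℂ v x = S x := fun x => InnerProductSpace.toDual_symm_apply
  have hlim : ∀ φ, Tendsto (fun n => inner ℂ (w n) φ) atTop (𝓝 (inner ℂ v φ)) := fun φ => by
    rw [hvS]; exact hS φ
  refine ⟨v, ?_, ?_, fun φ => ?_⟩
  · refine ext_inner_right ℂ fun x => ?_
    rw [hT]
    refine tendsto_nhds_unique (hlim (T x)) ?_
    simp only [← hT]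
    exact hu.inner tendsto_const_nhds
  · rw [hv, LinearIsometryEquiv.norm_map]
    exact S.opNorm_le_bound hM hSM
  · simpa only [Function.comp_def, inner_conj_symm] using
      (Complex.continuous_conj.tendsto _).comp (hlim φ)

theorem tendsto_of_weak_of_norm {ι : Type*} {l : Filter ι} {w : ι → H} {v : H}
    (h1 : Tendsto (fun i => inner ℂ v (w i)) l (𝓝 (inner ℂ v v)))
    (h2 : Tendsto (fun i => ‖w i‖) l (𝓝 ‖v‖)) : Tendsto w l (𝓝 v) := by
  rw [tendsto_iff_norm_sub_tendsto_zero]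
  have h3 : Tendsto (fun i => ‖v‖ ^ 2 - 2 * (inner ℂ v (w i)).re + ‖w i‖ ^ 2) l (𝓝 0) := by
    have := ((tendsto_const_nhds (x := ‖v‖ ^ 2)).sub
      (((Complex.continuous_re.tendsto _).comp h1).const_mul 2)).add (h2.pow 2)
    have e : ‖v‖ ^ 2 - 2 * (inner ℂ v v : ℂ).re + ‖v‖ ^ 2 = 0 := by
      have : (inner ℂ v v : ℂ).re = ‖v‖ ^ 2 := by
        rw [inner_self_eq_norm_sq_to_K]; norm_cast
      rw [this]; ring
    rwa [e] at this
  have h4 := h3.sqrt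
  rw [Real.sqrt_zero] at h4
  refine h4.congr fun i => ?_
  rw [norm_sub_rev, Real.sqrt_eq_iff_eq_sq ?_ (norm_nonneg _), norm_sub_sq (𝕜 := ℂ)]
  · rfl
  · have := norm_sub_sq (𝕜 := ℂ) v (w i)
    have h5 := sq_nonneg ‖v - w i‖
    rw [this] at h5
    exact h5

theorem tendsto_inner_of_dense {ι G : Type*} {l : Filter ι} {w : ι → H} {v : H} {M : ℝ}
    (hw : ∀ᶠ i in l, ‖w i‖ ≤ M) {g : G → H} (hg : DenseRange g)
    (h : ∀ y, Tendsto (fun i => inner ℂ (g y) (w i)) l (𝓝 (inner ℂ (g y) v))) (φ : H) :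
    Tendsto (fun i => inner ℂ φ (w i)) l (𝓝 (inner ℂ φ v)) := by
  rw [Metric.tendsto_nhds]
  intro δ hδ
  set K := |M| + ‖v‖ + 1 with hK
  have hK0 : 0 < K := by positivity
  obtain ⟨y, hy⟩ := hg.exists_dist_lt φ (ε := δ / (3 * K)) (by positivity)
  rw [dist_eq_norm, lt_div_iff₀ (by positivity)] at hy
  have hdiff : ∀ x : H, ‖x‖ ≤ K → dist (inner ℂ φ x) (inner ℂ (g y) x) < δ / 3 := by
    intro x hx
    rw [dist_eq_norm, ← inner_sub_left]
    have := norm_inner_le_norm (𝕜 := ℂ) (φ - g y) x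
    nlinarith [norm_nonneg (φ - g y)]
  filter_upwards [hw, Metric.tendsto_nhds.1 (h y) (δ / 3) (by positivity)] with i hi1 hi2
  have h1 := hdiff (w i) (by linarith [le_abs_self M, norm_nonneg v])
  have h2 := hdiff v (by linarith [abs_nonneg M])
  rw [dist_comm] at h2
  linarith [dist_triangle4 (inner ℂ φ (w i)) (inner ℂ (g y) (w i)) (inner ℂ (g y) v) (inner ℂ φ v)]

end Limits

/-! ### The limiting evolution of a resolvent family. -/

section Evolution

variable {H : Type*} [NormedAddCommGroup H] [InnerProductSpace ℂ H] [CompleteSpace H]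
  {R : ℝ → H →L[ℂ] H} {C : ℝ}

/-- `V n z s` are the propagators of the approximations `i (1 - (R z + (n+1)⁻¹)⁻¹)`. -/
structure IsApproxPropagator (R : ℝ → H →L[ℂ] H) (V : ℕ → ℝ → ℝ → H →L[ℂ] H) : Prop where
  diag : ∀ n s x, V n s s x = x
  norm_map : ∀ n z s x, ‖V n z s x‖ = ‖x‖
  comp : ∀ n z y s x, V n z y (V n y s x) = V n z s x
  deriv : ∀ n s x z, HasDerivAt (fun z => V n z s x)
    (Complex.I • (V n z s x - yosida R (1 / ((n : ℝ) + 1)) z (V n z s x))) z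

theorem ResolventFamily.exists_approxPropagator (hR : ResolventFamily R C) :
    ∃ V, IsApproxPropagator R V := by
  have h : ∀ n : ℕ, 0 < 1 / ((n : ℝ) + 1) := fun n => Nat.one_div_pos_of_nat
  choose V h1 h2 h3 h4 using fun n : ℕ => exists_propagator (H := H)
    (A := fun z => Complex.I • (1 - yosida R (1 / ((n : ℝ) + 1)) z))
    ((continuous_const.sub (hR.continuous_yosida (h n))).const_smul Complex.I)
    (fun z x => by simpa using! hR.re_inner_generator (h n) z x)
  exact ⟨V, fun n s x => by simp [h1], h2, h3, fun n s x z => by simpa using! h4 n s x z⟩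

namespace IsApproxPropagator

variable {V : ℕ → ℝ → ℝ → H →L[ℂ] H}

theorem norm_yosida_le (hV : IsApproxPropagator R V) (hR : ResolventFamily R C) (n : ℕ) (z s : ℝ)
    (y : H) : ‖yosida R (1 / ((n : ℝ) + 1)) z (V n z s (R s y))‖ ≤ ‖y‖ * Real.exp (C * |z - s|) := by
  have h : 0 < 1 / ((n : ℝ) + 1) := Nat.one_div_pos_of_nat
  refine (hR.norm_yosida_solution_le h (hV.deriv n s (R s y)) s z).trans ?_
  rw [hV.diag]
  gcongr
  exact hR.norm_yosida_map_le h s y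

theorem cauchySeq (hV : IsApproxPropagator R V) (hR : ResolventFamily R C) (z s : ℝ) (y : H) :
    CauchySeq fun n => V n z s (R s y) := by
  set M := ‖y‖ * Real.exp (C * |z - s|) with hM
  have hC := hR.const_nonneg
  refine cauchySeq_of_le_tendsto_0
    -- The 8 is the 4 of the difference estimate times 2, because both ε and δ are at most 1/(N +
    -- 1).
    (fun N : ℕ => Real.sqrt (8 * M ^ 2 * |z - s| * (1 / ((N : ℝ) + 1)))) (fun n m N hn hm => ?_) ?_
  · rw [dist_eq_norm]
    refine Real.le_sqrt_of_sq_le ?_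
    have hb : ∀ (n : ℕ) z', |z' - s| ≤ |z - s| →
        ‖yosida R (1 / ((n : ℝ) + 1)) z' (V n z' s (R s y))‖ ≤ M := fun n z' hz' =>
      (hV.norm_yosida_le hR n z' s y).trans (by rw [hM]; gcongr)
    have := hR.norm_sub_sq_le (Nat.one_div_pos_of_nat (n := n)) (Nat.one_div_pos_of_nat (n := m))
      (hV.deriv n s (R s y)) (hV.deriv m s (R s y)) (s := s) (by rw [hV.diag, hV.diag])
      (hb n) (hb m) le_rfl
    refine this.trans ?_
    have hn' : 1 / ((n : ℝ) + 1) ≤ 1 / ((N : ℝ) + 1) := Nat.one_div_le_one_div hn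
    have hm' : 1 / ((m : ℝ) + 1) ≤ 1 / ((N : ℝ) + 1) := Nat.one_div_le_one_div hm
    have : 0 ≤ 4 * M ^ 2 * |z - s| := by positivity
    nlinarith
  · have := ((tendsto_one_div_add_atTop_nhds_zero_nat (𝕜 := ℝ)).const_mul (8 * M ^ 2 * |z - s|)).sqrt
    simpa using this

theorem norm_sub_le (hV : IsApproxPropagator R V) (hR : ResolventFamily R C) (n : ℕ) (s : ℝ) (y : H)
    {T z z' : ℝ} (hz : |z - s| ≤ T) (hz' : |z' - s| ≤ T) :
    ‖V n z s (R s y) - V n z' s (R s y)‖ ≤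
      (‖R s y‖ + ‖y‖ * Real.exp (C * T)) * |z - z'| := by
  have hC := hR.const_nonneg
  refine (convex_closedBall s T).norm_image_sub_le_of_norm_hasDerivWithin_le
    (f := fun z => V n z s (R s y))
    (fun x _ => (hV.deriv n s (R s y) x).hasDerivWithinAt) (fun x hx => ?_)
    (by rwa [Metric.mem_closedBall, Real.dist_eq]) (by rwa [Metric.mem_closedBall, Real.dist_eq])
  rw [Metric.mem_closedBall, Real.dist_eq] at hx
  rw [norm_smul, Complex.norm_I, one_mul]
  refine (_root_.norm_sub_le _ _).trans ?_
  rw [hV.norm_map]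
  gcongr
  exact (hV.norm_yosida_le hR n x s y).trans (by gcongr)

end IsApproxPropagator

/-- The propagators converge on the dense range of R(s), hence everywhere. The function w is
L(z)U(z,s)R(s)y, obtained as the weak limit of Y_ε u. -/
theorem ResolventFamily.exists_evolution (hR : ResolventFamily R C) :
    ∃ U : ℝ → ℝ → H →L[ℂ] H, (∀ s x, U s s x = x) ∧ (∀ z s x, ‖U z s x‖ = ‖x‖) ∧
      (∀ z y s x, U z y (U y s x) = U z s x) ∧
      (∀ x, Continuous fun p : ℝ × ℝ => U p.1 p.2 x) ∧
      ∀ s y, ∃ w : ℝ → H, Continuous w ∧ (∀ z, U z s (R s y) = R z (w z)) ∧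
        ∀ z, HasDerivAt (fun z => U z s (R s y)) (Complex.I • (U z s (R s y) - w z)) z := by
  obtain ⟨V, hV⟩ := hR.exists_approxPropagator
  have hC := hR.const_nonneg
  choose U hU _ using fun z s => exists_strong_limit (T := fun n => V n z s) zero_le_one
    (fun n x => by rw [hV.norm_map, one_mul]) (hR.dense s) (fun y => hV.cauchySeq hR z s y)
  have hdiag : ∀ s x, U s s x = x := fun s x => tendsto_nhds_unique (hU s s x) (by simp [hV.diag])
  have hnorm : ∀ z s x, ‖U z s x‖ = ‖x‖ := fun z s x =>
    tendsto_nhds_unique (hU z s x).norm (by simp [hV.norm_map])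
  have hcomp : ∀ z y s x, U z y (U y s x) = U z s x := by
    intro z y s x
    refine tendsto_nhds_unique ?_ (hU z s x)
    have h1 : Tendsto (fun n => V n z y (U y s x)) atTop (𝓝 (U z y (U y s x))) := hU z y _
    refine h1.congr_dist ?_
    have h2 : Tendsto (fun n => ‖U y s x - V n y s x‖) atTop (𝓝 0) := by
      simpa using ((tendsto_const_nhds (x := U y s x)).sub (hU y s x)).norm
    refine h2.congr fun n => ?_
    rw [← hV.comp n z y s x, dist_eq_norm, ← map_sub, hV.norm_map]
  have hlip : ∀ s y T z z', |z - s| ≤ T → |z' - s| ≤ T → ‖U z s (R s y) - U z' s (R s y)‖ ≤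
      (‖R s y‖ + ‖y‖ * Real.exp (C * T)) * |z - z'| := fun s y T z z' hz hz' =>
    le_of_tendsto' ((hU z s _).sub (hU z' s _)).norm fun n => hV.norm_sub_le hR n s y hz hz'
  have hcontD : ∀ s y, Continuous fun z => U z s (R s y) := by
    intro s y
    rw [continuous_iff_continuousAt]
    intro z
    have hev : ∀ᶠ z' in 𝓝 z, |z' - s| ≤ |z - s| + 1 := by
      have : Continuous fun z' => |z' - s| := by fun_prop
      filter_upwards [this.continuousAt.eventually (gt_mem_nhds (lt_add_one |z - s|))] with z' h
        using h.le
    rw [ContinuousAt, tendsto_iff_norm_sub_tendsto_zero]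
    refine squeeze_zero' (Eventually.of_forall fun _ => norm_nonneg _)
      (hev.mono fun z' hz' => hlip s y (|z - s| + 1) z' z hz' (by linarith)) ?_
    have : Continuous fun z' =>
      (‖R s y‖ + ‖y‖ * Real.exp (C * (|z - s| + 1))) * |z' - z| := by fun_prop
    simpa using this.tendsto z
  have hcont1 : ∀ s x, Continuous fun z => U z s x := by
    intro s x
    refine continuous_of_uniform_approx_of_continuous fun r hr => ?_
    obtain ⟨ε, hε, hr⟩ := Metric.mem_uniformity_dist.1 hr
    obtain ⟨y, hy⟩ := (hR.dense s).exists_dist_lt x hε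
    refine ⟨_, hcontD s y, fun z => hr ?_⟩
    rwa [dist_eq_norm, ← map_sub, hnorm, ← dist_eq_norm]
  -- Continuity in the second variable comes from the first: applying the isometry U 0 s' gives ‖U 0
  -- s x - U 0 s' x‖ = ‖x - U s' 0 (U 0 s x)‖.
  have hcont2 : ∀ x, Continuous fun s => U 0 s x := by
    intro x
    rw [continuous_iff_continuousAt]
    intro s
    rw [ContinuousAt, tendsto_iff_norm_sub_tendsto_zero]
    have h : Tendsto (fun s' => ‖x - U s' 0 (U 0 s x)‖) (𝓝 s) (𝓝 0) := by
      have : Continuous fun s' => ‖x - U s' 0 (U 0 s x)‖ :=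
        (continuous_const.sub (hcont1 0 _)).norm
      simpa [hcomp, hdiag] using this.tendsto s
    refine h.congr fun s' => ?_
    have e : U 0 s x = U 0 s' (U s' 0 (U 0 s x)) := by rw [hcomp, hdiag]
    conv_rhs => rw [e, ← map_sub, hnorm]
  have hcont : ∀ x, Continuous fun p : ℝ × ℝ => U p.1 p.2 x := by
    intro x
    have e : (fun p : ℝ × ℝ => U p.1 p.2 x) = fun p : ℝ × ℝ => U p.1 0 (U 0 p.2 x) := by
      ext p; rw [hcomp]
    rw [e, continuous_iff_continuousAt]
    intro p
    have h1 : Tendsto (fun q : ℝ × ℝ => U q.1 0 (U 0 p.2 x)) (𝓝 p) (𝓝 (U p.1 0 (U 0 p.2 x))) :=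
      ((hcont1 0 (U 0 p.2 x)).comp continuous_fst).tendsto p
    refine h1.congr_dist ?_
    have h2 : Tendsto (fun q : ℝ × ℝ => ‖U 0 p.2 x - U 0 q.2 x‖) (𝓝 p) (𝓝 0) := by
      have : Continuous fun q : ℝ × ℝ => ‖U 0 p.2 x - U 0 q.2 x‖ :=
        (continuous_const.sub ((hcont2 x).comp continuous_snd)).norm
      simpa using this.tendsto p
    refine h2.congr fun q => ?_
    rw [dist_eq_norm, ← map_sub, hnorm]
  refine ⟨U, hdiag, hnorm, hcomp, hcont, ?_⟩
  let wn : ℕ → ℝ → H → ℝ → H := fun n s y z => yosida R (1 / ((n : ℝ) + 1)) z (V n z s (R s y))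
  have hRw : ∀ s y z, Tendsto (fun n => R z (wn n s y z)) atTop (𝓝 (U z s (R s y))) := by
    intro s y z
    have h0 : Tendsto (fun n : ℕ => ((1 / ((n : ℝ) + 1) : ℝ) : ℂ) • wn n s y z) atTop (𝓝 0) := by
      refine squeeze_zero_norm (a := fun n : ℕ =>
        1 / ((n : ℝ) + 1) * (‖y‖ * Real.exp (C * |z - s|))) (fun n => ?_) ?_
      · rw [norm_smul, Complex.norm_real, Real.norm_of_nonneg (by positivity)]
        gcongr
        exact hV.norm_yosida_le hR n z s y
      · simpa using (tendsto_one_div_add_atTop_nhds_zero_nat (𝕜 := ℝ)).mul_const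
          (‖y‖ * Real.exp (C * |z - s|))
    have := (hU z s (R s y)).sub h0
    rw [sub_zero] at this
    refine this.congr fun n => ?_
    rw [sub_eq_iff_eq_add]
    exact (hR.add_yosida Nat.one_div_pos_of_nat z _).symm
  choose w hw hwM hwlim using fun s y z => exists_weak_limit (hR.symm z) (hR.dense z)
    (fun n => hV.norm_yosida_le hR n z s y) (hRw s y z)
  -- Restarting at z gives the same w, because R z' is injective. The exponential bound therefore
  -- holds between any two points, in both directions.
  have hwle : ∀ s y z z', ‖w s y z'‖ ≤ ‖w s y z‖ * Real.exp (C * |z' - z|) := by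
    intro s y z z'
    have : w s y z' = w z (w s y z) z' := by
      apply hR.injective z'
      rw [hw, hw, hw, hcomp]
    rw [this]
    exact hwM _ _ _
  intro s y
  -- The two-sided exponential bound makes the norm of w continuous. Weak continuity follows by
  -- testing on the range of R z, where R z' (w z') = U z' s (R s y) is continuous. Together they
  -- give norm continuity.
  have hwc : Continuous (w s y) := by
    rw [continuous_iff_continuousAt]
    intro z
    have hexp1 : Tendsto (fun z' => Real.exp (C * |z' - z|)) (𝓝 z) (𝓝 1) := by
      have : Continuous fun z' => Real.exp (C * |z' - z|) := by fun_prop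
      simpa using this.tendsto z
    have hn : Tendsto (fun z' => ‖w s y z'‖) (𝓝 z) (𝓝 ‖w s y z‖) := by
      refine tendsto_of_tendsto_of_tendsto_of_le_of_le (g := fun z' =>
        ‖w s y z‖ / Real.exp (C * |z' - z|)) (h := fun z' => ‖w s y z‖ * Real.exp (C * |z' - z|))
        ?_ ?_ (fun z' => ?_) (fun z' => hwle s y z z')
      · simpa [Pi.div_def] using (tendsto_const_nhds (x := ‖w s y z‖)).div hexp1 one_ne_zero
      · simpa using hexp1.const_mul ‖w s y z‖
      · show _ / _ ≤ _
        rw [div_le_iff₀ (Real.exp_pos _), abs_sub_comm]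
        exact hwle s y z' z
    have hbd : ∀ᶠ z' in 𝓝 z, ‖w s y z'‖ ≤ ‖w s y z‖ + 1 := by
      filter_upwards [hn.eventually (gt_mem_nhds (lt_add_one ‖w s y z‖))] with z' h using h.le
    refine tendsto_of_weak_of_norm
      (tendsto_inner_of_dense hbd (hR.dense z) (fun x => ?_) (w s y z)) hn
    have h1 : Tendsto (fun z' => inner ℂ (R z' x) (w s y z')) (𝓝 z)
        (𝓝 (inner ℂ (R z x) (w s y z))) := by
      simp only [hR.symm, hw]
      exact tendsto_const_nhds.inner ((hcontD s y).tendsto z)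
    have h2 : Tendsto (fun z' => (‖R z x - R z' x‖) * (‖w s y z‖ + 1)) (𝓝 z) (𝓝 0) := by
      have : Continuous fun z' => (‖R z x - R z' x‖) * (‖w s y z‖ + 1) := by
        have := hR.continuous
        fun_prop
      simpa using this.tendsto z
    have h3 : Tendsto (fun z' => inner ℂ (R z x - R z' x) (w s y z')) (𝓝 z) (𝓝 0) := by
      refine squeeze_zero_norm' (hbd.mono fun z' hz' => ?_) h2
      exact (norm_inner_le_norm _ _).trans (by gcongr)
    have := h1.add h3
    rw [add_zero] at this
    refine this.congr fun z' => ?_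
    rw [← inner_add_left]
    congr 1
    abel
  refine ⟨w s y, hwc, fun z => (hw s y z).symm, fun z => ?_⟩
  have hgc : Continuous fun z => Complex.I • (U z s (R s y) - w s y z) :=
    ((hcontD s y).sub hwc).const_smul _
  -- The derivatives of the approximations converge only weakly, so the limit is taken in the
  -- integrated equation tested against φ. The integrand of the limit is continuous, and the
  -- fundamental theorem of calculus then gives the derivative.
  have hint : ∀ z, ∫ t in s..z, Complex.I • (U t s (R s y) - w s y t) =
      U z s (R s y) - R s y := by
    intro z
    refine ext_inner_left ℂ fun φ => ?_
    have e1 : inner ℂ φ (∫ t in s..z, Complex.I • (U t s (R s y) - w s y t)) =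
        ∫ t in s..z, inner ℂ φ (Complex.I • (U t s (R s y) - w s y t)) :=
      ((innerSL ℂ φ).intervalIntegral_comp_comm (hgc.intervalIntegrable s z)).symm
    rw [e1]
    have hdn : ∀ n t, HasDerivAt (fun t => inner ℂ φ (V n t s (R s y)))
        (inner ℂ φ (Complex.I • (V n t s (R s y) - wn n s y t))) t := fun n t =>
      ((innerSL ℂ φ).restrictScalars ℝ).hasFDerivAt.comp_hasDerivAt t (hV.deriv n s (R s y) t)
    have hwnc : ∀ n, Continuous fun t =>
        inner ℂ φ (Complex.I • (V n t s (R s y) - wn n s y t)) := by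
      intro n
      have h1 : Continuous fun t => V n t s (R s y) :=
        continuous_iff_continuousAt.2 fun t => (hV.deriv n s (R s y) t).continuousAt
      exact continuous_const.inner ((h1.sub
        ((hR.continuous_yosida Nat.one_div_pos_of_nat).clm_apply h1)).const_smul _)
    have e2 : ∀ n, ∫ t in s..z, inner ℂ φ (Complex.I • (V n t s (R s y) - wn n s y t)) =
        inner ℂ φ (V n z s (R s y)) - inner ℂ φ (R s y) := by
      intro n
      rw [intervalIntegral.integral_eq_sub_of_hasDerivAt (fun t _ => hdn n t)
        ((hwnc n).intervalIntegrable _ _), hV.diag]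
    have l1 : Tendsto (fun n => ∫ t in s..z,
        inner ℂ φ (Complex.I • (V n t s (R s y) - wn n s y t))) atTop
        (𝓝 (∫ t in s..z, inner ℂ φ (Complex.I • (U t s (R s y) - w s y t)))) := by
      refine intervalIntegral.tendsto_integral_filter_of_dominated_convergence
        (fun t => ‖φ‖ * (‖R s y‖ + ‖y‖ * Real.exp (C * |t - s|)))
        (Eventually.of_forall fun n => (hwnc n).aestronglyMeasurable)
        (Eventually.of_forall fun n => ae_of_all _ fun t _ => ?_)
        (Continuous.intervalIntegrable (by fun_prop) _ _)
        (ae_of_all _ fun t _ => ?_)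
      · refine (norm_inner_le_norm _ _).trans ?_
        gcongr
        rw [norm_smul, Complex.norm_I, one_mul]
        refine (norm_sub_le _ _).trans ?_
        rw [hV.norm_map]
        gcongr
        exact hV.norm_yosida_le hR n t s y
      · simp only [inner_smul_right, inner_sub_right]
        exact ((tendsto_const_nhds.inner (hU t s _)).sub (hwlim s y t φ)).const_mul _
    refine tendsto_nhds_unique l1 ?_
    simp only [e2, inner_sub_right]
    exact (tendsto_const_nhds.inner (hU z s _)).sub tendsto_const_nhds
  have h := (intervalIntegral.integral_hasDerivAt_right (hgc.intervalIntegrable s z)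
    (hgc.stronglyMeasurableAtFilter _ _) hgc.continuousAt).add_const (R s y)
  refine h.congr_of_eventuallyEq (Eventually.of_forall fun t => ?_)
  simp [hint t]

end Evolution
end Paraxial
end


noncomputable section
namespace Paraxial

open FourierTransform TemperedDistribution
open scoped BoundedContinuousFunction NNReal ENNReal

/-! ### Fourier multipliers on L² and the Sobolev scale. -/

section Multipliers

variable {d : ℕ}

theorem L2.ext_distribution {f g : L2 d} (h : (f : 𝓢'(E d, ℂ)) = (g : 𝓢'(E d, ℂ))) : f = g :=
  L2.toTemperedDistribution_injective d h

/-- Multiplication by a bounded continuous function on `L²(ℝ^d)`. -/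
def mulL2 (g : E d →ᵇ ℂ) : L2 d →L[ℂ] L2 d :=
  LinearMap.mkContinuous
    { toFun := fun f => ((g.memLp_top (μ := volume)).toLp g : Lp ℂ ∞ (volume : Measure (E d))) • f
      map_add' := fun _ _ => Lp.add_smul _ _ _
      map_smul' := fun _ _ => (Lp.smul_comm _ _ _).symm }
    ‖(g.memLp_top (μ := volume)).toLp g‖ (fun f => Lp.norm_smul_le _ f)

theorem mulL2_apply (g : E d →ᵇ ℂ) (f : L2 d) :
    mulL2 g f = ((g.memLp_top (μ := volume)).toLp g : Lp ℂ ∞ (volume : Measure (E d))) • f := rfl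

theorem coeFn_mulL2 (g : E d →ᵇ ℂ) (f : L2 d) : mulL2 g f =ᵐ[volume] fun x => g x * f x := by
  rw [mulL2_apply]
  filter_upwards [Lp.coeFn_lpSMul (r := 2) ((g.memLp_top (μ := volume)).toLp g) f,
    (g.memLp_top (μ := volume)).coeFn_toLp] with x h1 h2
  rw [h1, Pi.smul_apply', h2, smul_eq_mul]

theorem norm_mulL2_le (g : E d →ᵇ ℂ) (f : L2 d) {C : ℝ} (hC : ∀ x, ‖g x‖ ≤ C) :
    ‖mulL2 g f‖ ≤ C * ‖f‖ := by
  refine Lp.norm_le_mul_norm_of_ae_le_mul ?_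
  filter_upwards [coeFn_mulL2 g f] with x hx
  rw [hx, norm_mul]
  gcongr
  exact hC x

theorem inner_mulL2 (g : E d →ᵇ ℂ) (f h : L2 d) :
    inner ℂ (mulL2 g f) h = inner ℂ f (mulL2 (star g) h) := by
  rw [L2.inner_def, L2.inner_def]
  refine integral_congr_ae ?_
  filter_upwards [coeFn_mulL2 g f, coeFn_mulL2 (star g) h] with x h1 h2
  rw [h1, h2]
  simp
  ring

/-- The Fourier multiplier on `L²(ℝ^d)` with a bounded continuous symbol. -/
def fmul (g : E d →ᵇ ℂ) : L2 d →L[ℂ] L2 d :=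
  (Lp.fourierTransformₗᵢ (E d) ℂ).symm.toContinuousLinearEquiv.toContinuousLinearMap ∘L
    mulL2 g ∘L (Lp.fourierTransformₗᵢ (E d) ℂ).toContinuousLinearEquiv.toContinuousLinearMap

theorem fmul_apply (g : E d →ᵇ ℂ) (f : L2 d) : fmul g f = 𝓕⁻ (mulL2 g (𝓕 f)) := rfl

theorem fourier_fmul (g : E d →ᵇ ℂ) (f : L2 d) : 𝓕 (fmul g f) = mulL2 g (𝓕 f) :=
  fourier_fourierInv_eq _

theorem fmul_eq_of_ae {g : E d →ᵇ ℂ} {f h : L2 d}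
    (H : ∀ᵐ x, g x * (𝓕 f : L2 d) x = (𝓕 h : L2 d) x) : fmul g f = h := by
  apply (Lp.fourierTransformₗᵢ (E d) ℂ).injective
  show 𝓕 (fmul g f) = 𝓕 h
  rw [fourier_fmul]
  refine Lp.ext ?_
  filter_upwards [coeFn_mulL2 g (𝓕 f), H] with x h1 h2
  rw [h1, h2]

theorem fmul_mul (g₁ g₂ : E d →ᵇ ℂ) (f : L2 d) : fmul (g₁ * g₂) f = fmul g₁ (fmul g₂ f) := by
  refine fmul_eq_of_ae ?_
  rw [fourier_fmul, fourier_fmul]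
  filter_upwards [coeFn_mulL2 g₁ (mulL2 g₂ (𝓕 f)), coeFn_mulL2 g₂ (𝓕 f)] with x h1 h2
  rw [h1, h2, BoundedContinuousFunction.mul_apply, mul_assoc]

theorem fmul_comm (g₁ g₂ : E d →ᵇ ℂ) (f : L2 d) : fmul g₁ (fmul g₂ f) = fmul g₂ (fmul g₁ f) := by
  rw [← fmul_mul, mul_comm, fmul_mul]

theorem fmul_one (f : L2 d) : fmul 1 f = f :=
  fmul_eq_of_ae (Filter.Eventually.of_forall fun x => by simp)

theorem fmul_add (g₁ g₂ : E d →ᵇ ℂ) (f : L2 d) : fmul (g₁ + g₂) f = fmul g₁ f + fmul g₂ f := by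
  refine fmul_eq_of_ae ?_
  rw [FourierTransform.fourier_add, fourier_fmul, fourier_fmul]
  filter_upwards [coeFn_mulL2 g₁ (𝓕 f), coeFn_mulL2 g₂ (𝓕 f),
    Lp.coeFn_add (mulL2 g₁ (𝓕 f)) (mulL2 g₂ (𝓕 f))] with x h1 h2 h3
  rw [h3, Pi.add_apply, h1, h2, BoundedContinuousFunction.add_apply, add_mul]

theorem fmul_smul (a : ℂ) (g : E d →ᵇ ℂ) (f : L2 d) : fmul (a • g) f = a • fmul g f := by
  refine fmul_eq_of_ae ?_
  rw [FourierTransform.fourier_smul, fourier_fmul]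
  filter_upwards [coeFn_mulL2 g (𝓕 f), Lp.coeFn_smul a (mulL2 g (𝓕 f))] with x h1 h2
  rw [h2, Pi.smul_apply, h1, BoundedContinuousFunction.smul_apply, smul_eq_mul, smul_eq_mul,
    mul_assoc]

theorem fmul_sum {ι : Type*} (s : Finset ι) (g : ι → E d →ᵇ ℂ) (f : L2 d) :
    fmul (∑ i ∈ s, g i) f = ∑ i ∈ s, fmul (g i) f := by
  classical
  induction s using Finset.induction_on with
  | empty =>
    have := fmul_smul 0 (0 : E d →ᵇ ℂ) f
    simpa using this
  | insert i s hi ih => rw [Finset.sum_insert hi, Finset.sum_insert hi, fmul_add, ih]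

theorem norm_fmul_le (g : E d →ᵇ ℂ) (f : L2 d) {C : ℝ} (hC : ∀ x, ‖g x‖ ≤ C) :
    ‖fmul g f‖ ≤ C * ‖f‖ := by
  rw [← Lp.norm_fourier_eq (fmul g f), ← Lp.norm_fourier_eq f, fourier_fmul]
  exact norm_mulL2_le g _ hC

theorem inner_fmul (g : E d →ᵇ ℂ) (f h : L2 d) :
    inner ℂ (fmul g f) h = inner ℂ f (fmul (star g) h) := by
  rw [← Lp.inner_fourier_eq, ← Lp.inner_fourier_eq f, fourier_fmul, fourier_fmul, inner_mulL2]

theorem coe_fmul (g : E d →ᵇ ℂ) (hg : Function.HasTemperateGrowth g) (f : L2 d) :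
    (fmul g f : 𝓢'(E d, ℂ)) = fourierMultiplierCLM ℂ g (f : 𝓢'(E d, ℂ)) := by
  rw [fmul_apply, mulL2_apply, ← Lp.fourierInv_toTemperedDistribution_eq,
    Lp.toTemperedDistribution_smul_eq (by exact hg), ← Lp.fourier_toTemperedDistribution_eq,
    fourierMultiplierCLM_apply]

theorem hasTemperateGrowth_jsymbol (d : ℕ) (s : ℝ≥0) : Function.HasTemperateGrowth
    fun x : E d => (((1 + ‖x‖ ^ 2) ^ (-(s : ℝ) / 2) : ℝ) : ℂ) := by
  fun_prop

theorem hasTemperateGrowth_dsymbol (j : Fin d) : Function.HasTemperateGrowth fun x : E d =>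
    ((inner ℝ x (EuclideanSpace.single j (1 : ℝ) : E d) *
      (1 + ‖x‖ ^ 2) ^ (-1 / 2 : ℝ) : ℝ) : ℂ) := by
  fun_prop

/-- The symbol `(1 + |ξ|²)^(-s/2)`. -/
def jsymbol (d : ℕ) (s : ℝ≥0) : E d →ᵇ ℂ :=
  BoundedContinuousFunction.ofNormedAddCommGroup
    (fun x => (((1 + ‖x‖ ^ 2) ^ (-(s : ℝ) / 2) : ℝ) : ℂ))
    (hasTemperateGrowth_jsymbol d s).1.continuous 1 (fun x => by
      rw [Complex.norm_real, Real.norm_of_nonneg (by positivity)]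
      exact Real.rpow_le_one_of_one_le_of_nonpos (by simp) (by
        have := s.2; exact div_nonpos_of_nonpos_of_nonneg (neg_nonpos.2 this) zero_le_two))

theorem jsymbol_apply (s : ℝ≥0) (x : E d) :
    jsymbol d s x = (((1 + ‖x‖ ^ 2) ^ (-(s : ℝ) / 2) : ℝ) : ℂ) := rfl

theorem norm_jsymbol_le (s : ℝ≥0) (x : E d) : ‖jsymbol d s x‖ ≤ 1 := by
  rw [jsymbol_apply, Complex.norm_real, Real.norm_of_nonneg (by positivity)]
  exact Real.rpow_le_one_of_one_le_of_nonpos (by simp)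
    (div_nonpos_of_nonpos_of_nonneg (neg_nonpos.2 s.2) zero_le_two)

theorem norm_inner_mul_rpow_le (j : Fin d) (x : E d) :
    ‖inner ℝ x (EuclideanSpace.single j (1 : ℝ) : E d) * (1 + ‖x‖ ^ 2) ^ (-1 / 2 : ℝ)‖ ≤ 1 := by
  rw [norm_mul, Real.norm_of_nonneg (by positivity : (0 : ℝ) ≤ (1 + ‖x‖ ^ 2) ^ (-1 / 2 : ℝ)),
    neg_div, Real.rpow_neg (by positivity), ← Real.sqrt_eq_rpow]
  refine mul_inv_le_one_of_le₀ ?_ (by positivity)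
  refine (norm_inner_le_norm _ _).trans ?_
  rw [PiLp.norm_single, norm_one, mul_one]
  exact Real.le_sqrt_of_sq_le (by linarith)

/-- The symbol `2πi ξⱼ (1 + |ξ|²)^(-1/2)`. -/
def dsymbol (j : Fin d) : E d →ᵇ ℂ :=
  (2 * Real.pi * Complex.I : ℂ) • BoundedContinuousFunction.ofNormedAddCommGroup
    (fun x => ((inner ℝ x (EuclideanSpace.single j (1 : ℝ) : E d) *
      (1 + ‖x‖ ^ 2) ^ (-1 / 2 : ℝ) : ℝ) : ℂ))
    (hasTemperateGrowth_dsymbol j).1.continuous 1 (fun x => by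
      rw [Complex.norm_real]
      exact norm_inner_mul_rpow_le j x)

theorem dsymbol_apply (j : Fin d) (x : E d) :
    dsymbol j x = (2 * Real.pi * Complex.I : ℂ) * ((x j * (1 + ‖x‖ ^ 2) ^ (-1 / 2 : ℝ) : ℝ) : ℂ) := by
  have : (inner ℝ x (EuclideanSpace.single j (1 : ℝ) : E d)) = x j := by
    rw [EuclideanSpace.inner_single_right]; simp
  rw [← this]
  rfl

theorem norm_dsymbol_le (j : Fin d) (x : E d) : ‖dsymbol j x‖ ≤ 2 * Real.pi := by
  have := norm_inner_mul_rpow_le j x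
  rw [EuclideanSpace.inner_single_right] at this
  rw [dsymbol_apply, norm_mul, Complex.norm_real]
  have e : ‖(2 * Real.pi * Complex.I : ℂ)‖ = 2 * Real.pi := by
    simp [abs_of_pos Real.pi_pos]
  rw [e]
  exact mul_le_of_le_one_right (by positivity) (by simpa using this)

/-- The smoothing operator `𝓕⁻¹ (1 + |ξ|²)^(-s/2) 𝓕`, an isometry of `L²` onto `H^s`. -/
def J (d : ℕ) (s : ℝ≥0) : L2 d →L[ℂ] L2 d := fmul (jsymbol d s)

/-- The operator `∂ⱼ 𝓕⁻¹ (1 + |ξ|²)^(-1/2) 𝓕`, bounded on `L²`. -/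
def D (j : Fin d) : L2 d →L[ℂ] L2 d := fmul (dsymbol j)

theorem coe_J (s : ℝ≥0) (f : L2 d) :
    (J d s f : 𝓢'(E d, ℂ)) = besselPotential (E d) ℂ (-s) (f : 𝓢'(E d, ℂ)) := by
  rw [J, coe_fmul _ (hasTemperateGrowth_jsymbol d s)]
  rfl

theorem coe_D (j : Fin d) (f : L2 d) : (D j f : 𝓢'(E d, ℂ)) = besselPotential (E d) ℂ (-1)
    (∂_{(EuclideanSpace.single j (1 : ℝ) : E d)} (f : 𝓢'(E d, ℂ))) := by
  have ht := hasTemperateGrowth_dsymbol j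
  rw [besselPotential_neg_one_lineDerivOp_eq, D, dsymbol, coe_fmul]
  · rw [← smul_apply, ← fourierMultiplierCLM_smul ht]
    rfl
  · show Function.HasTemperateGrowth ((2 * Real.pi * Complex.I : ℂ) • fun x : E d =>
      Complex.ofReal (inner ℝ x (EuclideanSpace.single j (1 : ℝ) : E d) *
        (1 + ‖x‖ ^ 2) ^ (-1 / 2 : ℝ)))
    exact (Function.HasTemperateGrowth.const _).mul ht

theorem besselPotential_injective (s : ℝ) :
    Function.Injective (besselPotential (E d) ℂ s) := by
  intro u v h
  have h2 := congrArg (besselPotential (E d) ℂ (-s)) h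
  simpa using h2

theorem coe_eq_J_iff (s : ℝ≥0) (u : 𝓢'(E d, ℂ)) (f : L2 d) :
    u = (J d s f : 𝓢'(E d, ℂ)) ↔ besselPotential (E d) ℂ s u = f := by
  rw [coe_J]
  constructor
  · rintro rfl; simp
  · intro h; rw [← h]; simp

/-- H² is the range of the bounded injective operator J², so an operator with domain H² can be
studied as a bounded operator on L² after composition with J². -/
theorem memH2_iff (v : L2 d) : MemH2 v ↔ ∃ f, v = J d 2 f := by
  refine exists_congr fun f => ?_
  have := coe_eq_J_iff 2 (v : 𝓢'(E d, ℂ)) f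
  exact this.symm.trans ⟨L2.ext_distribution, fun h => by rw [h]⟩

theorem J_J (s t : ℝ≥0) (f : L2 d) : J d s (J d t f) = J d (s + t) f := by
  apply L2.ext_distribution
  simp only [coe_J, besselPotential_besselPotential_apply]
  congr 2
  push_cast
  ring

theorem J_zero (f : L2 d) : J d 0 f = f := by
  apply L2.ext_distribution
  simp [coe_J]

theorem J_injective (s : ℝ≥0) : Function.Injective (J d s) := by
  intro f g h
  apply L2.ext_distribution
  apply besselPotential_injective (-(s : ℝ))
  rw [← coe_J, ← coe_J, h]

theorem J_D (s : ℝ≥0) (j : Fin d) (f : L2 d) : J d s (D j f) = D j (J d s f) := fmul_comm _ _ _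

theorem inner_J (s : ℝ≥0) (f g : L2 d) : inner ℂ (J d s f) g = inner ℂ f (J d s g) := by
  have : star (jsymbol d s) = jsymbol d s := by
    ext x; simp [jsymbol_apply]
  rw [J, inner_fmul, this]

theorem inner_D (j : Fin d) (f g : L2 d) : inner ℂ (D j f) g = -inner ℂ f (D j g) := by
  have : star (dsymbol j) = (-1 : ℂ) • dsymbol j := by
    ext x; simp [dsymbol_apply]
  rw [D, inner_fmul, this, fmul_smul, inner_smul_right, neg_one_mul]

theorem norm_J_le (s : ℝ≥0) (f : L2 d) : ‖J d s f‖ ≤ ‖f‖ := by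
  exact (norm_fmul_le (jsymbol d s) f (norm_jsymbol_le s)).trans_eq (one_mul _)

theorem norm_D_le (j : Fin d) (f : L2 d) : ‖D j f‖ ≤ 2 * Real.pi * ‖f‖ :=
  norm_fmul_le _ f (norm_dsymbol_le j)

theorem denseRange_J (s : ℝ≥0) : DenseRange (J d s) := by
  have h : (LinearMap.range (J d s).toLinearMap).topologicalClosure = ⊤ := by
    rw [Submodule.topologicalClosure_eq_top_iff, Submodule.eq_bot_iff]
    intro x hx
    refine J_injective s (ext_inner_left ℂ fun y => ?_)
    rw [← inner_J, map_zero, inner_zero_right]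
    exact hx (J d s y) ⟨y, rfl⟩
  exact Submodule.dense_iff_topologicalClosure_eq_top.2 h

/-- Applying the injective Bessel potential of order -1 to both sides turns a statement about
distributions into an identity in L². -/
theorem lineDeriv_eq_iff (j : Fin d) (v g : L2 d) :
    ∂_{(EuclideanSpace.single j (1 : ℝ) : E d)} (v : 𝓢'(E d, ℂ)) = (g : 𝓢'(E d, ℂ)) ↔
      D j v = J d 1 g := by
  rw [← (besselPotential_injective (d := d) (-1)).eq_iff, ← coe_D]
  have : besselPotential (E d) ℂ (-1) (g : 𝓢'(E d, ℂ)) = (J d 1 g : 𝓢'(E d, ℂ)) := by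
    simp [coe_J]
  rw [this]
  exact ⟨L2.ext_distribution, fun h => by rw [h]⟩

theorem sum_lineDeriv_eq_iff (q : Fin d → L2 d) (w : L2 d) :
    ∑ j, ∂_{(EuclideanSpace.single j (1 : ℝ) : E d)} (q j : 𝓢'(E d, ℂ)) = (w : 𝓢'(E d, ℂ)) ↔
      ∑ j, D j (q j) = J d 1 w := by
  rw [← (besselPotential_injective (d := d) (-1)).eq_iff, map_sum]
  simp only [← coe_D]
  have : besselPotential (E d) ℂ (-1) (w : 𝓢'(E d, ℂ)) = (J d 1 w : 𝓢'(E d, ℂ)) := by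
    simp [coe_J]
  rw [this]
  have e : ∑ j, (D j (q j) : 𝓢'(E d, ℂ)) = ((∑ j, D j (q j) : L2 d) : 𝓢'(E d, ℂ)) :=
    (map_sum (Lp.toTemperedDistributionCLM ℂ volume 2) _ _).symm
  rw [e]
  exact ⟨L2.ext_distribution, fun h => by rw [h]⟩

theorem isDivGrad_iff (a : E d → ℝ) (v w : L2 d) : IsDivGrad a v w ↔
    ∃ g q : Fin d → L2 d, (∀ j, D j v = J d 1 (g j)) ∧ (∀ j, ∀ᵐ x, q j x = (a x : ℂ) * g j x) ∧
      ∑ j, D j (q j) = J d 1 w := by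
  simp only [IsDivGrad, lineDeriv_eq_iff, sum_lineDeriv_eq_iff]

/-- On the Fourier side, 1 - (1 + |ξ|²)⁻¹ = |ξ|² / (1 + |ξ|²). The factor 4π² comes from the
convention that ∂ⱼ has symbol 2πiξⱼ. -/
theorem eq_J_two_sub_sum (f : L2 d) :
    ((4 * Real.pi ^ 2 : ℝ) : ℂ) • (f - J d 2 f) = -∑ j, D j (D j f) := by
  have h : ((4 * Real.pi ^ 2 : ℝ) : ℂ) • (1 : E d →ᵇ ℂ) =
      ((4 * Real.pi ^ 2 : ℝ) : ℂ) • jsymbol d 2 + (-1 : ℂ) • ∑ j, dsymbol j * dsymbol j := by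
    ext x
    have hx : (0 : ℝ) < 1 + ‖x‖ ^ 2 := by positivity
    have e : (((1 + ‖x‖ ^ 2) ^ (-1 / 2 : ℝ) : ℝ) : ℂ) * (((1 + ‖x‖ ^ 2) ^ (-1 / 2 : ℝ) : ℝ) : ℂ) =
        (((1 + ‖x‖ ^ 2)⁻¹ : ℝ) : ℂ) := by
      rw [← Complex.ofReal_mul, ← Real.rpow_add hx, ← Real.rpow_neg_one]
      norm_num
    have e2 : ∀ j, dsymbol j x * dsymbol j x =
        -(4 * (Real.pi : ℂ) ^ 2) * (((1 + ‖x‖ ^ 2)⁻¹ : ℝ) : ℂ) * ((x j ^ 2 : ℝ) : ℂ) := fun j => by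
      rw [dsymbol_apply, ← e]
      push_cast
      linear_combination (4 * (Real.pi : ℂ) ^ 2 * (x j : ℂ) ^ 2 *
        (((1 + ‖x‖ ^ 2) ^ (-1 / 2 : ℝ) : ℝ) : ℂ) ^ 2) * Complex.I_sq
    have e3 : ∑ j, (x j) ^ 2 = ‖x‖ ^ 2 := by
      rw [EuclideanSpace.norm_sq_eq]; simp
    have e4 : jsymbol d 2 x = (((1 + ‖x‖ ^ 2)⁻¹ : ℝ) : ℂ) := by
      rw [jsymbol_apply, ← Real.rpow_neg_one]
      norm_num
    simp only [BoundedContinuousFunction.coe_smul, BoundedContinuousFunction.coe_add,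
      BoundedContinuousFunction.coe_one, Pi.add_apply, Pi.one_apply,
      BoundedContinuousFunction.sum_apply, BoundedContinuousFunction.mul_apply, e2, e4,
      ← Finset.mul_sum, ← Complex.ofReal_sum, e3, smul_eq_mul]
    have hx' : ((1 + ‖x‖ ^ 2 : ℝ) : ℂ) ≠ 0 := by exact_mod_cast hx.ne'
    push_cast at hx' ⊢
    field_simp
  have := congrArg (fun g => fmul g f) h
  simp only [fmul_add, fmul_smul, fmul_sum, fmul_mul, fmul_one] at this
  rw [smul_sub, this]
  simp [J, D]

end Multipliers
end Paraxial
end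


noncomputable section
namespace Paraxial

open FourierTransform TemperedDistribution Filter Topology
open scoped BoundedContinuousFunction NNReal ENNReal

/-! ### Young's inequality and a weighted convolution bound. -/

section Young

theorem sq_lintegral_mul_le {α : Type*} [MeasurableSpace α] {μ : Measure α} {f g : α → ℝ≥0∞}
    (hf : AEMeasurable f μ) (hg : AEMeasurable g μ) :
    (∫⁻ x, f x * g x ∂μ) ^ 2 ≤ (∫⁻ x, f x ^ 2 ∂μ) * ∫⁻ x, g x ^ 2 ∂μ := by
  have h := ENNReal.lintegral_mul_norm_pow_le (hf.pow_const 2) (hg.pow_const 2)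
    (p := 1 / 2) (q := 1 / 2) (by norm_num) (by norm_num) (by norm_num)
  have e : ∀ t : ℝ≥0∞, (t ^ 2) ^ (1 / 2 : ℝ) = t := fun t => by
    rw [← ENNReal.rpow_natCast, ← ENNReal.rpow_mul]; norm_num
  have e' : ∀ t : ℝ≥0∞, (t ^ (1 / 2 : ℝ)) ^ 2 = t := fun t => by
    rw [← ENNReal.rpow_natCast, ← ENNReal.rpow_mul]; norm_num
  simp only [e] at h
  calc _ ≤ ((∫⁻ x, f x ^ 2 ∂μ) ^ (1 / 2 : ℝ) * (∫⁻ x, g x ^ 2 ∂μ) ^ (1 / 2 : ℝ)) ^ 2 := by gcongr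
    _ = _ := by rw [mul_pow, e', e']

variable {V : Type*} [AddCommGroup V] [MeasurableSpace V] [MeasurableAdd₂ V] [MeasurableNeg V]
  {μ : Measure V} [SFinite μ] [μ.IsAddLeftInvariant]

/-- Young's inequality `‖a * k‖_{L²} ≤ ‖a‖_{L¹} ‖k‖_{L²}`. -/
theorem lintegral_conv_sq_le {a k : V → ℝ≥0∞} (ha : Measurable a) (hk : Measurable k) :
    ∫⁻ ξ, (∫⁻ η, a η * k (ξ - η) ∂μ) ^ 2 ∂μ ≤ (∫⁻ η, a η ∂μ) ^ 2 * ∫⁻ ξ, k ξ ^ 2 ∂μ := by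
  have e : ∀ t : ℝ≥0∞, t ^ (1 / 2 : ℝ) * t ^ (1 / 2 : ℝ) = t := fun t => by
    rw [← ENNReal.rpow_add_of_nonneg _ _ (by norm_num) (by norm_num)]; norm_num
  -- Cauchy–Schwarz for the measure a dμ, by splitting a into two square roots.
  have h1 : ∀ ξ, (∫⁻ η, a η * k (ξ - η) ∂μ) ^ 2 ≤
      (∫⁻ η, a η ∂μ) * ∫⁻ η, a η * k (ξ - η) ^ 2 ∂μ := by
    intro ξ
    have hm : Measurable fun η => k (ξ - η) := hk.comp (measurable_const.sub measurable_id)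
    have := sq_lintegral_mul_le (μ := μ) (f := fun η => a η ^ (1 / 2 : ℝ))
      (g := fun η => a η ^ (1 / 2 : ℝ) * k (ξ - η)) (by fun_prop) (by fun_prop)
    simp only [← mul_assoc, e, mul_pow] at this
    simpa only [sq, e, mul_assoc] using this
  calc _ ≤ ∫⁻ ξ, (∫⁻ η, a η ∂μ) * ∫⁻ η, a η * k (ξ - η) ^ 2 ∂μ ∂μ := lintegral_mono h1
    _ = (∫⁻ η, a η ∂μ) * ∫⁻ ξ, ∫⁻ η, a η * k (ξ - η) ^ 2 ∂μ ∂μ := by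
      refine lintegral_const_mul _ (Measurable.lintegral_prod_right'
        (f := fun p : V × V => a p.2 * k (p.1 - p.2) ^ 2) ?_)
      fun_prop
    _ = (∫⁻ η, a η ∂μ) * ∫⁻ η, ∫⁻ ξ, a η * k (ξ - η) ^ 2 ∂μ ∂μ := by
      rw [lintegral_lintegral_swap]
      exact Measurable.aemeasurable (by unfold Function.uncurry; fun_prop)
    _ = (∫⁻ η, a η ∂μ) * ∫⁻ η, a η * ∫⁻ ξ, k ξ ^ 2 ∂μ ∂μ := by
      congr 1
      refine lintegral_congr fun η => ?_
      rw [lintegral_const_mul _ (by fun_prop), lintegral_sub_right_eq_self (fun ξ => k ξ ^ 2) η]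
    _ = _ := by
      rw [lintegral_mul_const _ ha, sq, mul_assoc]

/-- The hypothesis on the weights moves the whole weight onto one factor. Then n φ or n ψ is bounded
in L¹ by Cauchy–Schwarz, and Young applies. The 4 is 2 + 2, from (a + b)² ≤ 2a² + 2b². -/
theorem lintegral_weighted_conv_sq_le [μ.IsNegInvariant] {m₁ m₂ n φ ψ : V → ℝ≥0∞} (hn : Measurable n)
    (hφ : Measurable φ) (hψ : Measurable ψ)
    (hm : ∀ x y, m₁ x * m₂ y ≤ n x + n y) :
    ∫⁻ ξ, (∫⁻ η, (m₁ η * φ η) * (m₂ (ξ - η) * ψ (ξ - η)) ∂μ) ^ 2 ∂μ ≤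
      4 * (∫⁻ x, n x ^ 2 ∂μ) * (∫⁻ x, φ x ^ 2 ∂μ) * ∫⁻ x, ψ x ^ 2 ∂μ := by
  have h1 : ∀ ξ, (∫⁻ η, (m₁ η * φ η) * (m₂ (ξ - η) * ψ (ξ - η)) ∂μ) ^ 2 ≤
      2 * (∫⁻ η, (n η * φ η) * ψ (ξ - η) ∂μ) ^ 2 + 2 * (∫⁻ η, (n η * ψ η) * φ (ξ - η) ∂μ) ^ 2 := by
    intro ξ
    have hm' : ∀ f : V → ℝ≥0∞, Measurable f → Measurable fun η => f (ξ - η) := fun f hf =>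
      hf.comp (measurable_const.sub measurable_id)
    have h2 : ∫⁻ η, (m₁ η * φ η) * (m₂ (ξ - η) * ψ (ξ - η)) ∂μ ≤
        (∫⁻ η, (n η * φ η) * ψ (ξ - η) ∂μ) + ∫⁻ η, (n η * ψ η) * φ (ξ - η) ∂μ := by
      have e : ∫⁻ η, (n η * ψ η) * φ (ξ - η) ∂μ = ∫⁻ η, (n (ξ - η) * ψ (ξ - η)) * φ η ∂μ := by
        rw [← lintegral_sub_left_eq_self (fun η => (n η * ψ η) * φ (ξ - η)) ξ]
        simp
      have := hm' ψ hψ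
      rw [e, ← lintegral_add_left (by fun_prop)]
      refine lintegral_mono fun η => ?_
      calc _ = (m₁ η * m₂ (ξ - η)) * (φ η * ψ (ξ - η)) := by ring
        _ ≤ (n η + n (ξ - η)) * (φ η * ψ (ξ - η)) := by gcongr; exact hm _ _
        _ = _ := by ring
    refine (pow_le_pow_left' h2 2).trans ?_
    rw [← mul_add]
    have := ENNReal.rpow_add_le_mul_rpow_add_rpow (∫⁻ η, (n η * φ η) * ψ (ξ - η) ∂μ)
      (∫⁻ η, (n η * ψ η) * φ (ξ - η) ∂μ) one_le_two
    norm_num at this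
    exact this
  have hb : ∀ f g : V → ℝ≥0∞, Measurable f → Measurable g →
      ∫⁻ ξ, (∫⁻ η, (n η * f η) * g (ξ - η) ∂μ) ^ 2 ∂μ ≤
      (∫⁻ x, n x ^ 2 ∂μ) * (∫⁻ x, f x ^ 2 ∂μ) * ∫⁻ x, g x ^ 2 ∂μ := fun f g hf hg =>
    (lintegral_conv_sq_le (hn.mul hf) hg).trans
      (by gcongr; exact sq_lintegral_mul_le hn.aemeasurable hf.aemeasurable)
  have hmeas : ∀ f g : V → ℝ≥0∞, Measurable f → Measurable g →
      Measurable fun ξ => (∫⁻ η, (n η * f η) * g (ξ - η) ∂μ) ^ 2 := fun f g hf hg =>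
    (Measurable.lintegral_prod_right'
      (f := fun p : V × V => (n p.2 * f p.2) * g (p.1 - p.2)) (by fun_prop)).pow_const 2
  refine (lintegral_mono h1).trans ?_
  rw [lintegral_add_left ((hmeas φ ψ hφ hψ).const_mul 2), lintegral_const_mul _ (hmeas φ ψ hφ hψ),
    lintegral_const_mul _ (hmeas ψ φ hψ hφ)]
  calc _ ≤ 2 * ((∫⁻ x, n x ^ 2 ∂μ) * (∫⁻ x, φ x ^ 2 ∂μ) * ∫⁻ x, ψ x ^ 2 ∂μ) +
        2 * ((∫⁻ x, n x ^ 2 ∂μ) * (∫⁻ x, ψ x ^ 2 ∂μ) * ∫⁻ x, φ x ^ 2 ∂μ) := by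
          gcongr
          · exact hb φ ψ hφ hψ
          · exact hb ψ φ hψ hφ
    _ = _ := by ring

end Young

/-! ### The Sobolev product estimate H^r · H^s ⊂ L² for r + s > d/2. -/

section Product

variable {d : ℕ}

theorem enorm_sq_L2 (f : L2 d) : ‖f‖ₑ ^ 2 = ∫⁻ x, ‖f x‖ₑ ^ 2 := by
  have := eLpNorm_nnreal_pow_eq_lintegral (μ := (volume : Measure (E d))) (f := f) (p := 2)
    two_ne_zero
  rw [Lp.enorm_def]
  simpa using this

theorem enorm_sq_toLp (f : 𝓢(E d, ℂ)) : ‖f.toLp 2 volume‖ₑ ^ 2 = ∫⁻ x, ‖f x‖ₑ ^ 2 := by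
  rw [enorm_sq_L2]
  refine lintegral_congr_ae ?_
  filter_upwards [f.coeFn_toLp 2 volume] with x hx
  rw [hx]

theorem lintegral_fourierInv_sq (f : 𝓢(E d, ℂ)) :
    ∫⁻ x, ‖(𝓕⁻ f) x‖ₑ ^ 2 = ∫⁻ x, ‖f x‖ₑ ^ 2 := by
  rw [← enorm_sq_toLp, ← enorm_sq_toLp, ← ofReal_norm, ← ofReal_norm,
    ← SchwartzMap.norm_fourier_toL2_eq, fourier_fourierInv_eq]

/-- The operator `J` on Schwartz functions. -/
def JS (d : ℕ) (s : ℝ≥0) : 𝓢(E d, ℂ) →L[ℂ] 𝓢(E d, ℂ) :=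
  SchwartzMap.fourierMultiplierCLM ℂ fun x : E d => (((1 + ‖x‖ ^ 2) ^ (-(s : ℝ) / 2) : ℝ) : ℂ)

theorem J_toLp (s : ℝ≥0) (f : 𝓢(E d, ℂ)) : J d s (f.toLp 2 volume) = (JS d s f).toLp 2 volume := by
  apply L2.ext_distribution
  rw [coe_J]
  simp only [Lp.toTemperedDistribution_toLp_eq, besselPotential, JS]
  exact fourierMultiplierCLM_toTemperedDistributionCLM_eq (hasTemperateGrowth_jsymbol d s) f

theorem fourierInv_JS_apply (s : ℝ≥0) (f : 𝓢(E d, ℂ)) (x : E d) :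
    (𝓕⁻ (JS d s f)) x = jsymbol d s x * (𝓕⁻ f) x := by
  -- The multiplier is defined through 𝓕 but needed through 𝓕⁻. The two differ by x ↦ -x, and the
  -- symbol is even.
  have h : ∀ (g : 𝓢(E d, ℂ)), (𝓕⁻ g) x = (𝓕 g) (-x) := fun g => by
    rw [SchwartzMap.fourierInv_coe, Real.fourierInv_eq_fourier_neg, SchwartzMap.fourier_coe]
  rw [h, h, JS, SchwartzMap.fourierMultiplierCLM_apply, fourier_fourierInv_eq,
    SchwartzMap.smulLeftCLM_apply_apply (hasTemperateGrowth_jsymbol d s), norm_neg, smul_eq_mul]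
  rfl

/-- With p = (1 + |x|²)⁻¹ and q = (1 + |y|²)⁻¹, the product p^(r/2) q^(s/2) is at most the larger of
p and q to the power (r + s)/2. -/
theorem enorm_jsymbol_mul_le (r s : ℝ≥0) (x y : E d) :
    ‖jsymbol d r x‖ₑ * ‖jsymbol d s y‖ₑ ≤ ‖jsymbol d (r + s) x‖ₑ + ‖jsymbol d (r + s) y‖ₑ := by
  have hm : ∀ (t : ℝ≥0) (z : E d), ‖jsymbol d t z‖ = (((1 + ‖z‖ ^ 2)⁻¹) ^ ((t : ℝ) / 2) : ℝ) := by
    intro t z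
    rw [jsymbol_apply, Complex.norm_real, Real.norm_of_nonneg (by positivity), neg_div,
      Real.rpow_neg (by positivity), Real.inv_rpow (by positivity)]
  have h : ‖jsymbol d r x‖ * ‖jsymbol d s y‖ ≤ ‖jsymbol d (r + s) x‖ + ‖jsymbol d (r + s) y‖ := by
    simp only [hm]
    set p := (1 + ‖x‖ ^ 2)⁻¹ with hp
    set q := (1 + ‖y‖ ^ 2)⁻¹ with hq
    have hp0 : 0 < p := by positivity
    have hq0 : 0 < q := by positivity
    have e : ∀ t : ℝ, 0 < t → t ^ (((r + s : ℝ≥0) : ℝ) / 2) = t ^ ((r : ℝ) / 2) * t ^ ((s : ℝ) / 2) :=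
      fun t ht => by rw [← Real.rpow_add ht]; push_cast; ring_nf
    rw [e p hp0, e q hq0]
    rcases le_total p q with h | h
    · have : p ^ ((r : ℝ) / 2) ≤ q ^ ((r : ℝ) / 2) := Real.rpow_le_rpow hp0.le h (by positivity)
      have h2 : 0 ≤ p ^ ((r : ℝ) / 2) * p ^ ((s : ℝ) / 2) := by positivity
      have h3 := mul_le_mul_of_nonneg_right this (by positivity : 0 ≤ q ^ ((s : ℝ) / 2))
      linarith
    · have : q ^ ((s : ℝ) / 2) ≤ p ^ ((s : ℝ) / 2) := Real.rpow_le_rpow hq0.le h (by positivity)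
      have h2 : 0 ≤ q ^ ((r : ℝ) / 2) * q ^ ((s : ℝ) / 2) := by positivity
      have h3 := mul_le_mul_of_nonneg_left this (by positivity : 0 ≤ p ^ ((r : ℝ) / 2))
      linarith
  simp only [← ofReal_norm]
  rw [← ENNReal.ofReal_mul (norm_nonneg _), ← ENNReal.ofReal_add (norm_nonneg _) (norm_nonneg _)]
  exact ENNReal.ofReal_le_ofReal h

/-- The constant in the product estimate. -/
def productConst (d : ℕ) (t : ℝ≥0) : ℝ≥0∞ := 4 * ∫⁻ x : E d, ‖jsymbol d t x‖ₑ ^ 2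

theorem productConst_lt_top {t : ℝ≥0} (h : (d : ℝ) < 2 * t) : productConst d t < ⊤ := by
  refine ENNReal.mul_lt_top (by norm_num) ?_
  have hi := integrable_rpow_neg_one_add_norm_sq (E := E d) (μ := volume) (r := 2 * t) (by simpa)
  refine lt_of_eq_of_lt ?_ hi.lintegral_lt_top
  refine lintegral_congr fun x => ?_
  rw [← ofReal_norm, ← ENNReal.ofReal_pow (norm_nonneg _), jsymbol_apply, Complex.norm_real,
    Real.norm_of_nonneg (by positivity), ← Real.rpow_natCast, ← Real.rpow_mul (by positivity)]
  congr 2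
  push_cast
  ring

/-- By Plancherel the product becomes a convolution in frequency, to which the weighted bound
applies. -/
theorem lintegral_JS_mul_JS_le (r s : ℝ≥0) (φ ψ : 𝓢(E d, ℂ)) :
    ∫⁻ x, ‖JS d r φ x * JS d s ψ x‖ₑ ^ 2 ≤
      productConst d (r + s) * (∫⁻ x, ‖φ x‖ₑ ^ 2) * ∫⁻ x, ‖ψ x‖ₑ ^ 2 := by
  set f := 𝓕⁻ (JS d r φ)
  set g := 𝓕⁻ (JS d s ψ)
  set p := SchwartzMap.convolution (ContinuousLinearMap.mul ℂ ℂ) f g with hp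
  have h1 : ∀ x, (𝓕 p) x = JS d r φ x * JS d s ψ x := fun x => by
    rw [hp, SchwartzMap.fourier_convolution, fourier_fourierInv_eq, fourier_fourierInv_eq,
      SchwartzMap.pairing_apply_apply, ContinuousLinearMap.mul_apply']
  simp only [← h1]
  rw [← lintegral_fourierInv_sq (𝓕 p), fourierInv_fourier_eq, ← lintegral_fourierInv_sq φ,
    ← lintegral_fourierInv_sq ψ]
  refine le_trans (lintegral_mono fun ξ => ?_) (lintegral_weighted_conv_sq_le
    (m₁ := fun x => ‖jsymbol d r x‖ₑ) (m₂ := fun x => ‖jsymbol d s x‖ₑ)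
    (n := fun x => ‖jsymbol d (r + s) x‖ₑ) (φ := fun x => ‖(𝓕⁻ φ) x‖ₑ)
    (ψ := fun x => ‖(𝓕⁻ ψ) x‖ₑ) (jsymbol d (r + s)).continuous.enorm.measurable
    (𝓕⁻ φ).continuous.enorm.measurable (𝓕⁻ ψ).continuous.enorm.measurable
    (enorm_jsymbol_mul_le r s))
  refine pow_le_pow_left' ?_ 2
  rw [hp, SchwartzMap.convolution_apply, convolution_def]
  refine (enorm_integral_le_lintegral_enorm _).trans_eq (lintegral_congr fun η => ?_)
  rw [ContinuousLinearMap.mul_apply', enorm_mul, fourierInv_JS_apply, fourierInv_JS_apply,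
    enorm_mul, enorm_mul]

theorem exists_seq_toLp (f : L2 d) :
    ∃ φ : ℕ → 𝓢(E d, ℂ), Tendsto (fun n => (φ n).toLp 2 volume) atTop (𝓝 f) := by
  have h : f ∈ closure (range (SchwartzMap.toLpCLM ℂ (E := E d) ℂ 2 volume)) :=
    SchwartzMap.denseRange_toLpCLM ENNReal.ofNat_ne_top f
  obtain ⟨u, hu, hlim⟩ := mem_closure_iff_seq_limit.1 h
  choose φ hφ using hu
  refine ⟨φ, hlim.congr fun n => (hφ n).symm⟩

/-- Density of Schwartz functions. The product of the limits is not known beforehand to lie in L²,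
so the bound passes through Fatou along a common almost everywhere convergent subsequence. -/
theorem lintegral_J_mul_J_le (r s : ℝ≥0) (G W : L2 d) (hC : productConst d (r + s) ≠ ⊤) :
    ∫⁻ x, ‖J d r G x * J d s W x‖ₑ ^ 2 ≤ productConst d (r + s) * ‖G‖ₑ ^ 2 * ‖W‖ₑ ^ 2 := by
  obtain ⟨φ, hφ⟩ := exists_seq_toLp G
  obtain ⟨ψ, hψ⟩ := exists_seq_toLp W
  have hφ' := ((J d r).continuous.tendsto G).comp hφ
  have hψ' := ((J d s).continuous.tendsto W).comp hψ
  obtain ⟨n₁, hn₁, h1⟩ := (tendstoInMeasure_of_tendsto_Lp hφ').exists_seq_tendsto_ae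
  obtain ⟨n₂, hn₂, h2⟩ :=
    (tendstoInMeasure_of_tendsto_Lp (hψ'.comp hn₁.tendsto_atTop)).exists_seq_tendsto_ae
  set k : ℕ → ℕ := n₁ ∘ n₂
  have hk : Tendsto k atTop atTop := hn₁.tendsto_atTop.comp hn₂.tendsto_atTop
  have hae : ∀ᵐ x, ∀ n, J d r ((φ n).toLp 2 volume) x = JS d r (φ n) x ∧
      J d s ((ψ n).toLp 2 volume) x = JS d s (ψ n) x := by
    rw [ae_all_iff]
    intro n
    rw [J_toLp, J_toLp]
    filter_upwards [(JS d r (φ n)).coeFn_toLp 2 volume, (JS d s (ψ n)).coeFn_toLp 2 volume]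
      with x hx hy using ⟨hx, hy⟩
  have hlim : ∀ᵐ x, ‖J d r G x * J d s W x‖ₑ ^ 2 =
      liminf (fun n => ‖JS d r (φ (k n)) x * JS d s (ψ (k n)) x‖ₑ ^ 2) atTop := by
    filter_upwards [h1, h2, hae] with x hx hy hxy
    have hx' := hx.comp hn₂.tendsto_atTop
    have : Tendsto (fun n => ‖JS d r (φ (k n)) x * JS d s (ψ (k n)) x‖ₑ ^ 2) atTop
        (𝓝 (‖J d r G x * J d s W x‖ₑ ^ 2)) := by
      refine ((ENNReal.continuous_pow 2).tendsto _).comp ((hx'.mul hy).enorm.congr fun n => ?_)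
      simp only [Function.comp_apply, k, (hxy _).1, (hxy _).2]
    exact this.liminf_eq.symm
  rw [lintegral_congr_ae hlim]
  refine (lintegral_liminf_le fun n => ?_).trans ?_
  · exact ((JS d r (φ (k n))).continuous.mul (JS d s (ψ (k n))).continuous).enorm.measurable.pow_const 2
  · have hT : Tendsto (fun n => productConst d (r + s) * ‖(φ (k n)).toLp 2 volume‖ₑ ^ 2 *
        ‖(ψ (k n)).toLp 2 volume‖ₑ ^ 2) atTop
        (𝓝 (productConst d (r + s) * ‖G‖ₑ ^ 2 * ‖W‖ₑ ^ 2)) := by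
      refine ENNReal.Tendsto.mul (ENNReal.Tendsto.const_mul (((ENNReal.continuous_pow 2).tendsto _).comp
        (hφ.comp hk).enorm) (Or.inr hC)) (Or.inr (by simp)) (((ENNReal.continuous_pow 2).tendsto _).comp
        (hψ.comp hk).enorm) (Or.inr ?_)
      exact ENNReal.mul_ne_top hC (by simp)
    rw [← hT.liminf_eq]
    refine liminf_le_liminf (Eventually.of_forall fun n => ?_)
    rw [enorm_sq_toLp, enorm_sq_toLp]
    exact lintegral_JS_mul_JS_le r s _ _

end Product
end Paraxial
end


noncomputable section
namespace Paraxial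

open FourierTransform TemperedDistribution Filter Topology
open scoped BoundedContinuousFunction NNReal ENNReal

/-! ### Multiplication as a bounded bilinear map, and the Leibniz rule. -/

section ProductOperator

variable {d : ℕ}

theorem eLpNorm_J_mul_J_le (r s : ℝ≥0) (hC : productConst d (r + s) < ⊤) (G W : L2 d) :
    eLpNorm (fun x => J d r G x * J d s W x) 2 volume ≤
      ENNReal.ofReal (Real.sqrt (productConst d (r + s)).toReal * ‖G‖ * ‖W‖) := by
  have h := lintegral_J_mul_J_le r s G W hC.ne
  have h2 := eLpNorm_nnreal_pow_eq_lintegral (μ := (volume : Measure (E d)))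
    (f := fun x => J d r G x * J d s W x) (p := 2) two_ne_zero
  have e : ENNReal.ofReal (Real.sqrt (productConst d (r + s)).toReal * ‖G‖ * ‖W‖) ^ 2 =
      productConst d (r + s) * ‖G‖ₑ ^ 2 * ‖W‖ₑ ^ 2 := by
    rw [← ENNReal.ofReal_pow (by positivity), mul_pow, mul_pow, Real.sq_sqrt ENNReal.toReal_nonneg,
      ENNReal.ofReal_mul (by positivity), ENNReal.ofReal_mul (by positivity),
      ENNReal.ofReal_toReal hC.ne, ENNReal.ofReal_pow (norm_nonneg _),
      ENNReal.ofReal_pow (norm_nonneg _), ofReal_norm, ofReal_norm]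
  rw [← e] at h
  have h3 : eLpNorm (fun x => J d r G x * J d s W x) 2 volume ^ 2 ≤
      ENNReal.ofReal (Real.sqrt (productConst d (r + s)).toReal * ‖G‖ * ‖W‖) ^ 2 := by
    refine le_trans (le_of_eq ?_) h
    simpa using h2
  exact (ENNReal.pow_le_pow_left_iff two_ne_zero).1 h3

theorem memLp_J_mul_J (r s : ℝ≥0) (hC : productConst d (r + s) < ⊤) (G W : L2 d) :
    MemLp (fun x => J d r G x * J d s W x) 2 volume :=
  ⟨(Lp.aestronglyMeasurable _).mul (Lp.aestronglyMeasurable _),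
    (eLpNorm_J_mul_J_le r s hC G W).trans_lt ENNReal.ofReal_lt_top⟩

/-- The product `(G, W) ↦ (J^r G) (J^s W)`, bounded on `L²(ℝ^d)` if `r + s > d / 2`. -/
def prodL2 (r s : ℝ≥0) (hC : productConst d (r + s) < ⊤) : L2 d →L[ℂ] L2 d →L[ℂ] L2 d :=
  LinearMap.mkContinuous₂ (LinearMap.mk₂ ℂ (fun G W => (memLp_J_mul_J r s hC G W).toLp _)
    (fun G G' W => by
      rw [← MemLp.toLp_add]
      refine MemLp.toLp_congr _ _ ?_
      rw [map_add]
      filter_upwards [Lp.coeFn_add (J d r G) (J d r G')] with x hx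
      rw [hx, Pi.add_apply, Pi.add_apply, add_mul])
    (fun a G W => by
      rw [← MemLp.toLp_const_smul]
      refine MemLp.toLp_congr _ _ ?_
      rw [map_smul]
      filter_upwards [Lp.coeFn_smul a (J d r G)] with x hx
      rw [hx, Pi.smul_apply, Pi.smul_apply, smul_mul_assoc])
    (fun G W W' => by
      rw [← MemLp.toLp_add]
      refine MemLp.toLp_congr _ _ ?_
      rw [map_add]
      filter_upwards [Lp.coeFn_add (J d s W) (J d s W')] with x hx
      rw [hx, Pi.add_apply, Pi.add_apply, mul_add])
    (fun a G W => by
      rw [← MemLp.toLp_const_smul]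
      refine MemLp.toLp_congr _ _ ?_
      rw [map_smul]
      filter_upwards [Lp.coeFn_smul a (J d s W)] with x hx
      rw [hx, Pi.smul_apply, Pi.smul_apply, mul_smul_comm]))
    (Real.sqrt (productConst d (r + s)).toReal) (fun G W => by
      rw [LinearMap.mk₂_apply, Lp.norm_toLp]
      exact ENNReal.toReal_le_of_le_ofReal (by positivity) (eLpNorm_J_mul_J_le r s hC G W))

theorem coeFn_prodL2 {r s : ℝ≥0} (hC : productConst d (r + s) < ⊤) (G W : L2 d) :
    prodL2 r s hC G W =ᵐ[volume] fun x => J d r G x * J d s W x :=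
  (memLp_J_mul_J r s hC G W).coeFn_toLp

theorem prodL2_eq_of_ae {r s : ℝ≥0} (hC : productConst d (r + s) < ⊤) {G W h : L2 d}
    (H : ∀ᵐ x, J d r G x * J d s W x = h x) : prodL2 r s hC G W = h :=
  Lp.ext ((coeFn_prodL2 hC G W).trans H)

/-- If the second factor has σ more derivatives than the product needs, the product is controlled by
J^σ W instead of W. This is what makes ∇b·∇v a lower order term. -/
theorem prodL2_J {r s t σ : ℝ≥0} (hC : productConst d (r + t) < ⊤) (hC' : productConst d (r + s) < ⊤)
    (ht : s + σ = t) (G W : L2 d) : prodL2 r t hC G W = prodL2 r s hC' G (J d σ W) := by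
  refine Lp.ext ((coeFn_prodL2 hC G W).trans ?_)
  filter_upwards [coeFn_prodL2 hC' G (J d σ W)] with x hx
  rw [hx, J_J, ht]

theorem lineDeriv_J (s : ℝ≥0) (j : Fin d) (f : L2 d) :
    ∂_{(EuclideanSpace.single j (1 : ℝ) : E d)} (J d (1 + s) f : 𝓢'(E d, ℂ)) =
      (J d s (D j f) : 𝓢'(E d, ℂ)) := by
  rw [lineDeriv_eq_iff, J_J, J_D]

theorem lineDeriv_toLp (j : Fin d) (φ : 𝓢(E d, ℂ)) :
    ∂_{(EuclideanSpace.single j (1 : ℝ) : E d)} (φ.toLp 2 volume : 𝓢'(E d, ℂ)) =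
      ((∂_{(EuclideanSpace.single j (1 : ℝ) : E d)} φ).toLp 2 volume : 𝓢'(E d, ℂ)) := by
  rw [Lp.toTemperedDistribution_toLp_eq, Lp.toTemperedDistribution_toLp_eq,
    lineDerivOp_toTemperedDistributionCLM_eq]

theorem J_D_toLp (s : ℝ≥0) (j : Fin d) (φ : 𝓢(E d, ℂ)) : J d s (D j (φ.toLp 2 volume)) =
    (∂_{(EuclideanSpace.single j (1 : ℝ) : E d)} (JS d (1 + s) φ)).toLp 2 volume := by
  apply L2.ext_distribution
  rw [← lineDeriv_J, J_toLp, lineDeriv_toLp]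

theorem lineDeriv_pairing (j : Fin d) (u v : 𝓢(E d, ℂ)) (x : E d) :
    (∂_{(EuclideanSpace.single j (1 : ℝ) : E d)}
      (SchwartzMap.pairing (ContinuousLinearMap.mul ℂ ℂ) u v)) x =
      (∂_{(EuclideanSpace.single j (1 : ℝ) : E d)} u) x * v x +
        u x * (∂_{(EuclideanSpace.single j (1 : ℝ) : E d)} v) x := by
  simp only [SchwartzMap.lineDerivOp_apply_eq_fderiv]
  have e : (SchwartzMap.pairing (ContinuousLinearMap.mul ℂ ℂ) u v : E d → ℂ) = fun x => u x * v x := by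
    ext y; simp [SchwartzMap.pairing_apply_apply]
  rw [e, fderiv_fun_mul u.differentiableAt v.differentiableAt]
  simp only [add_apply, smul_apply, smul_eq_mul]
  ring

/-- The Leibniz rule `∂ⱼ (b g) = (∂ⱼ b) g + b ∂ⱼ g` for `b ∈ H^(1+r)` and `g ∈ H¹`. -/
theorem D_prodL2 {r : ℝ≥0} (h₁ : productConst d (r + 1) < ⊤) (h₂ : productConst d (1 + r + 0) < ⊤)
    (j : Fin d) (β γ : L2 d) : D j (prodL2 (1 + r) 0 h₂ β (J d 1 γ)) =
      J d 1 (prodL2 r 1 h₁ (D j β) γ + prodL2 (1 + r) 0 h₂ β (D j γ)) := by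
  -- Both sides are continuous in β and γ, so the classical product rule for Schwartz functions
  -- suffices.
  refine DenseRange.induction_on₂ (p := fun β γ => D j (prodL2 (1 + r) 0 h₂ β (J d 1 γ)) =
      J d 1 (prodL2 r 1 h₁ (D j β) γ + prodL2 (1 + r) 0 h₂ β (D j γ)))
    (SchwartzMap.denseRange_toLpCLM (p := 2) ENNReal.ofNat_ne_top) ?_ (fun φ ψ => ?_) β γ
  · refine isClosed_eq ?_ ?_ <;> fun_prop
  · rw [← lineDeriv_eq_iff]
    simp only [SchwartzMap.toLpCLM_apply]
    set u := JS d (1 + r) φ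
    set v := JS d 1 ψ
    have e1 : prodL2 (1 + r) 0 h₂ (φ.toLp 2 volume) (J d 1 (ψ.toLp 2 volume)) =
        (SchwartzMap.pairing (ContinuousLinearMap.mul ℂ ℂ) u v).toLp 2 volume := by
      refine prodL2_eq_of_ae h₂ ?_
      rw [J_zero, J_toLp, J_toLp]
      filter_upwards [u.coeFn_toLp 2 volume, v.coeFn_toLp 2 volume,
        (SchwartzMap.pairing (ContinuousLinearMap.mul ℂ ℂ) u v).coeFn_toLp 2 volume] with x h1 h2 h3
      rw [h1, h2, h3, SchwartzMap.pairing_apply_apply, ContinuousLinearMap.mul_apply']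
    have hv : D j (ψ.toLp 2 volume) =
        (∂_{(EuclideanSpace.single j (1 : ℝ) : E d)} v).toLp 2 volume := by
      have := J_D_toLp 0 j ψ
      rwa [J_zero, add_zero] at this
    rw [e1, lineDeriv_toLp]
    congr 1
    refine Lp.ext ?_
    set p := SchwartzMap.pairing (ContinuousLinearMap.mul ℂ ℂ) u v
    have c1 := coeFn_prodL2 h₁ (D j (φ.toLp 2 volume)) (ψ.toLp 2 volume)
    have c2 := coeFn_prodL2 h₂ (φ.toLp 2 volume) (D j (ψ.toLp 2 volume))
    rw [J_D_toLp, J_toLp] at c1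
    rw [J_zero, hv, J_toLp] at c2
    rw [hv]
    filter_upwards [c1, c2, u.coeFn_toLp 2 volume, v.coeFn_toLp 2 volume,
      (∂_{(EuclideanSpace.single j (1 : ℝ) : E d)} u).coeFn_toLp 2 volume,
      (∂_{(EuclideanSpace.single j (1 : ℝ) : E d)} v).coeFn_toLp 2 volume,
      (∂_{(EuclideanSpace.single j (1 : ℝ) : E d)} p).coeFn_toLp 2 volume,
      Lp.coeFn_add (prodL2 r 1 h₁ (D j (φ.toLp 2 volume)) (ψ.toLp 2 volume))
        (prodL2 (1 + r) 0 h₂ (φ.toLp 2 volume)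
          ((∂_{(EuclideanSpace.single j (1 : ℝ) : E d)} v).toLp 2 volume))]
      with x k1 k2 k3 k4 k5 k6 k7 k8
    rw [k7, k8, Pi.add_apply, k1, k2, k3, k4, k5, k6, lineDeriv_pairing]

end ProductOperator

/-! ### The divergence-form operator pulled back to L². -/

section DivOp

variable {d : ℕ} {r : ℝ≥0} (h₁ : productConst d (r + 1) < ⊤) (h₂ : productConst d (1 + r + 0) < ⊤)

/-- The operator `∑ⱼ ∂ⱼ² J²`. -/
def lapOp (d : ℕ) : L2 d →L[ℂ] L2 d := ∑ j, D j ∘L D j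

theorem lapOp_apply (f : L2 d) : lapOp d f = ∑ j, D j (D j f) := by
  simp [lapOp]

/-- The operator `div (b ∇ J² ·)` with `b = J^(1+r) β`, as a function of `β`. -/
def perturbOp : L2 d →L[ℂ] L2 d →L[ℂ] L2 d :=
  ∑ j, ((ContinuousLinearMap.compL ℂ (L2 d) (L2 d) (L2 d)).flip (D j) ∘L prodL2 r 1 h₁ ∘L D j) +
    (ContinuousLinearMap.compL ℂ (L2 d) (L2 d) (L2 d)).flip (lapOp d) ∘L prodL2 (1 + r) 0 h₂

theorem perturbOp_apply (β f : L2 d) : perturbOp h₁ h₂ β f =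
    ∑ j, prodL2 r 1 h₁ (D j β) (D j f) + prodL2 (1 + r) 0 h₂ β (lapOp d f) := by
  simp [perturbOp]

/-- The operator `div ((c₀ + b) ∇ J² ·)` with `b = J^(1+r) β`. -/
def divOp (c₀ : ℝ) (β : L2 d) : L2 d →L[ℂ] L2 d := (c₀ : ℂ) • lapOp d + perturbOp h₁ h₂ β

/-- The flux `(c₀ + b) g` with `b = J^(1+r) β`. -/
def flux (c₀ : ℝ) (β g : L2 d) : L2 d := (c₀ : ℂ) • g + prodL2 (1 + r) 0 h₂ β g

theorem coeFn_flux (c₀ : ℝ) (β g : L2 d) :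
    flux h₂ c₀ β g =ᵐ[volume] fun x => ((c₀ : ℂ) + J d (1 + r) β x) * g x := by
  filter_upwards [coeFn_prodL2 h₂ β g, Lp.coeFn_add ((c₀ : ℂ) • g) (prodL2 (1 + r) 0 h₂ β g),
    Lp.coeFn_smul (c₀ : ℂ) g] with x k1 k2 k3
  rw [flux, k2, Pi.add_apply, k1, k3, J_zero, Pi.smul_apply, smul_eq_mul, add_mul]

theorem sum_D_flux (c₀ : ℝ) (β f : L2 d) :
    ∑ j, D j (flux h₂ c₀ β (J d 1 (D j f))) = J d 1 (divOp h₁ h₂ c₀ β f) := by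
  have : ∀ j, D j (flux h₂ c₀ β (J d 1 (D j f))) = J d 1 ((c₀ : ℂ) • D j (D j f) +
      (prodL2 r 1 h₁ (D j β) (D j f) + prodL2 (1 + r) 0 h₂ β (D j (D j f)))) := fun j => by
    rw [flux, map_add, map_smul, D_prodL2 h₁ h₂, map_add (J d 1) ((c₀ : ℂ) • D j (D j f)), map_smul]
    simp only [J_D]
  simp only [this]
  rw [← map_sum]
  congr 1
  simp only [divOp, add_apply, smul_apply, perturbOp_apply, lapOp_apply, map_sum,
    Finset.sum_add_distrib, Finset.smul_sum]

/-- Injectivity of J¹ forces the gradient and the flux in the definition, so the weak operator on H²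
is exactly `divOp`. -/
theorem isDivGrad_J_two_iff {c₀ : ℝ} {β : L2 d} {a : E d → ℝ}
    (ha : ∀ᵐ x, (a x : ℂ) = (c₀ : ℂ) + J d (1 + r) β x) (f w : L2 d) :
    IsDivGrad a (J d 2 f) w ↔ w = divOp h₁ h₂ c₀ β f := by
  rw [isDivGrad_iff]
  have hg : ∀ j, D j (J d 2 f) = J d 1 (J d 1 (D j f)) := fun j => by
    rw [J_J, one_add_one_eq_two, J_D]
  constructor
  · rintro ⟨g, q, h1, h2, h3⟩
    have hg' : ∀ j, g j = J d 1 (D j f) := fun j => J_injective 1 (by rw [← h1, hg])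
    have hq : ∀ j, q j = flux h₂ c₀ β (J d 1 (D j f)) := fun j => by
      refine Lp.ext ?_
      filter_upwards [h2 j, ha, coeFn_flux h₂ c₀ β (J d 1 (D j f))] with x k1 k2 k3
      rw [k1, k2, k3, hg']
    simp only [hq, sum_D_flux h₁ h₂] at h3
    exact (J_injective 1 h3).symm
  · rintro rfl
    refine ⟨fun j => J d 1 (D j f), fun j => flux h₂ c₀ β (J d 1 (D j f)), hg, fun j => ?_,
      sum_D_flux h₁ h₂ c₀ β f⟩
    filter_upwards [ha, coeFn_flux h₂ c₀ β (J d 1 (D j f))] with x k2 k3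
    rw [k2, k3]

/-- Integration by parts: one factor J¹ of J² moves to the left, where the divergence of the flux
appears, and D is antisymmetric. -/
theorem inner_divOp (c₀ : ℝ) (β f f' : L2 d) : inner ℂ (divOp h₁ h₂ c₀ β f) (J d 2 f') =
    -∑ j, inner ℂ (flux h₂ c₀ β (J d 1 (D j f))) (J d 1 (D j f')) := by
  have e : J d 2 f' = J d 1 (J d 1 f') := by rw [J_J, one_add_one_eq_two]
  rw [e, ← inner_J, ← sum_D_flux h₁ h₂, sum_inner,
    ← Finset.sum_neg_distrib]
  refine Finset.sum_congr rfl fun j _ => ?_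
  rw [inner_D]
  simp only [J_D]

/-- `b = J^(1+r) β` is real-valued and nonnegative. -/
def IsNonneg (r : ℝ≥0) (β : L2 d) : Prop := ∀ᵐ x, ∃ b : ℝ, 0 ≤ b ∧ J d (1 + r) β x = b

theorem IsNonneg.smul {β : L2 d} (hβ : IsNonneg r β) {t : ℝ} (ht : 0 ≤ t) :
    IsNonneg r ((t : ℂ) • β) := by
  unfold IsNonneg
  rw [map_smul]
  filter_upwards [hβ, Lp.coeFn_smul (t : ℂ) (J d (1 + r) β)] with x ⟨b, hb, hx⟩ h
  refine ⟨t * b, by positivity, ?_⟩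
  rw [h, Pi.smul_apply, hx, smul_eq_mul, Complex.ofReal_mul]

theorem IsNonneg.inner_flux_symm {β : L2 d} (hβ : IsNonneg r β) (c₀ : ℝ) (g g' : L2 d) :
    inner ℂ (flux h₂ c₀ β g) g' = inner ℂ g (flux h₂ c₀ β g') := by
  rw [L2.inner_def, L2.inner_def]
  refine integral_congr_ae ?_
  filter_upwards [hβ, coeFn_flux h₂ c₀ β g, coeFn_flux h₂ c₀ β g'] with x ⟨b, _, hx⟩ k1 k2
  rw [k1, k2, hx]
  simp
  ring

theorem IsNonneg.inner_flux_nonneg {β : L2 d} (hβ : IsNonneg r β) {c₀ : ℝ} (hc : 0 ≤ c₀) (g : L2 d) :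
    0 ≤ (inner ℂ (flux h₂ c₀ β g) g : ℂ).re := by
  have h := integral_re (L2.integrable_inner (𝕜 := ℂ) (flux h₂ c₀ β g) g)
  rw [L2.inner_def]
  refine le_of_le_of_eq ?_ h
  refine integral_nonneg_of_ae ?_
  filter_upwards [hβ, coeFn_flux h₂ c₀ β g] with x ⟨b, hb, hx⟩ k1
  rw [k1, hx, ← Complex.ofReal_add, ← smul_eq_mul, inner_smul_left, Complex.conj_ofReal,
    RCLike.re_to_complex, Complex.re_ofReal_mul, ← RCLike.re_to_complex]
  exact mul_nonneg (by positivity) inner_self_nonneg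

theorem IsNonneg.norm_le_flux {β : L2 d} (hβ : IsNonneg r β) {c₀ : ℝ} (hc : 0 ≤ c₀) (g : L2 d) :
    c₀ * ‖g‖ ≤ ‖flux h₂ c₀ β g‖ := by
  have : ‖(c₀ : ℂ) • g‖ ≤ ‖flux h₂ c₀ β g‖ := by
    refine Lp.norm_le_norm_of_ae_le ?_
    filter_upwards [hβ, coeFn_flux h₂ c₀ β g, Lp.coeFn_smul (c₀ : ℂ) g] with x ⟨b, hb, hx⟩ k1 k2
    rw [k1, hx, k2, Pi.smul_apply, smul_eq_mul, norm_mul, norm_mul, ← Complex.ofReal_add,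
      Complex.norm_real, Complex.norm_real, Real.norm_of_nonneg hc,
      Real.norm_of_nonneg (by positivity)]
    gcongr
    linarith
  rwa [norm_smul, Complex.norm_real, Real.norm_of_nonneg hc] at this

end DivOp
end Paraxial
end


noncomputable section
namespace Paraxial

open FourierTransform TemperedDistribution Filter Topology
open scoped BoundedContinuousFunction NNReal ENNReal

/-! ### The method of continuity. -/

section Continuity

variable {H : Type*} [NormedAddCommGroup H] [NormedSpace ℂ H]

/-- The method of continuity. -/
theorem isUnit_of_continuity_method [CompleteSpace H] {K T : H →L[ℂ] H} {C : ℝ} (hK : IsUnit K)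
    (h : ∀ t : ℝ, 0 ≤ t → t ≤ 1 → ∀ f, ‖f‖ ≤ C * ‖(K - (t : ℂ) • T) f‖) : IsUnit (K - T) := by
  rcases subsingleton_or_nontrivial H with hH | hH
  · rw [ContinuousLinearMap.isUnit_iff_bijective]
    exact ⟨Function.injective_of_subsingleton _, fun x => ⟨0, Subsingleton.elim _ _⟩⟩
  have hC : 0 < C := by
    obtain ⟨f, hf⟩ := exists_ne (0 : H)
    by_contra hC
    have h1 := h 0 le_rfl zero_le_one f
    have h2 : 0 < ‖f‖ := norm_pos_iff.2 hf
    nlinarith [norm_nonneg ((K - ((0 : ℝ) : ℂ) • T) f)]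
  -- A step of length 1/n changes the operator by ‖T‖/n < 1/C, less than the reciprocal norm of the
  -- current inverse, so invertibility survives it.
  obtain ⟨n, hn⟩ := exists_nat_gt (C * ‖T‖)
  have hn0 : (0 : ℝ) < n := (by positivity : 0 ≤ C * ‖T‖).trans_lt hn
  have step : ∀ k : ℕ, k ≤ n → IsUnit (K - (((k : ℝ) / n : ℝ) : ℂ) • T) := by
    intro k
    induction k with
    | zero => intro _; simpa using hK
    | succ k ih =>
      intro hk
      obtain ⟨u, hu⟩ := ih (by omega)
      have hk' : (k : ℝ) + 1 ≤ n := by exact_mod_cast hk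
      have hinv : ‖(↑u⁻¹ : H →L[ℂ] H)‖ ≤ C := by
        refine ContinuousLinearMap.opNorm_le_bound _ hC.le fun f => ?_
        have := h ((k : ℝ) / n) (by positivity) (by rw [div_le_one hn0]; linarith)
          ((↑u⁻¹ : H →L[ℂ] H) f)
        rwa [← hu, ← mul_apply_eq_comp, Units.mul_inv, one_apply_eq_self] at this
      have hpos : 0 < ‖(↑u⁻¹ : H →L[ℂ] H)‖ := Units.norm_pos _
      refine ⟨Units.ofNearby u _ ?_, rfl⟩
      have e : K - ((((k + 1 : ℕ) : ℝ) / n : ℝ) : ℂ) • T - u = -((((1 : ℝ) / n : ℝ) : ℂ) • T) := by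
        rw [hu, sub_sub_sub_cancel_left, ← sub_smul, ← neg_smul]
        congr 1
        push_cast
        ring
      rw [e, norm_neg, norm_smul, Complex.norm_real, Real.norm_of_nonneg (by positivity)]
      refine lt_of_lt_of_le ?_ (inv_anti₀ hpos hinv)
      rw [one_div, inv_mul_lt_iff₀ hn0, ← div_eq_mul_inv, lt_div_iff₀ hC, mul_comm]
      exact hn
  simpa [hn0.ne'] using step n le_rfl

theorem inverse_apply_self {T : H →L[ℂ] H} (h : IsUnit T) (f : H) : Ring.inverse T (T f) = f := by
  rw [← mul_apply_eq_comp, Ring.inverse_mul_cancel _ h, one_apply_eq_self]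

end Continuity

/-! ### The H² a priori estimate and the resolvents. -/

section Apriori

variable {d : ℕ}

theorem norm_fmul_le_norm_fmul {g₁ g₂ : E d →ᵇ ℂ} (h : ∀ x, ‖g₁ x‖ ≤ ‖g₂ x‖) (f : L2 d) :
    ‖fmul g₁ f‖ ≤ ‖fmul g₂ f‖ := by
  rw [← Lp.norm_fourier_eq (fmul g₁ f), ← Lp.norm_fourier_eq (fmul g₂ f), fourier_fmul, fourier_fmul]
  refine Lp.norm_le_norm_of_ae_le ?_
  filter_upwards [coeFn_mulL2 g₁ (𝓕 f), coeFn_mulL2 g₂ (𝓕 f)] with x h1 h2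
  rw [h1, h2, norm_mul, norm_mul]
  gcongr
  exact h x

/-- The interpolation inequality `‖v‖_{H^(2-σ)} ≤ δ ‖v‖_{H²} + C ‖v‖_{L²}`. -/
theorem exists_interpolation (d : ℕ) {σ : ℝ≥0} (hσ : 0 < σ) {δ : ℝ} (hδ : 0 < δ) :
    ∃ C : ℝ, 0 ≤ C ∧ ∀ f : L2 d, ‖J d σ f‖ ≤ δ * ‖f‖ + C * ‖J d 2 f‖ := by
  have hσ' : (0 : ℝ) < σ := hσ
  -- With p = (1 + |x|²)⁻¹, either p^(σ/2) ≤ δ or p ≥ δ^(2/σ). In the second case C p ≥ 1 ≥ p^(σ/2).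
  set C := (δ ^ (2 / (σ : ℝ)))⁻¹ with hC
  have hC0 : 0 < C := by positivity
  refine ⟨C, hC0.le, fun f => ?_⟩
  have key : ∀ x : E d, ‖jsymbol d σ x‖ ≤ ‖((δ : ℂ) • (1 : E d →ᵇ ℂ) + (C : ℂ) • jsymbol d 2) x‖ := by
    intro x
    set p : ℝ := (1 + ‖x‖ ^ 2)⁻¹ with hp
    have hp0 : 0 < p := by positivity
    have hp1 : p ≤ 1 := inv_le_one_of_one_le₀ (by simp)
    have e1 : jsymbol d σ x = ((p ^ ((σ : ℝ) / 2) : ℝ) : ℂ) := by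
      rw [jsymbol_apply, neg_div, Real.rpow_neg (by positivity), Real.inv_rpow (by positivity)]
    have e2 : jsymbol d 2 x = (p : ℂ) := by
      rw [jsymbol_apply, hp, ← Real.rpow_neg_one]
      norm_num
    have e3 : ((δ : ℂ) • (1 : E d →ᵇ ℂ) + (C : ℂ) • jsymbol d 2) x = ((δ + C * p : ℝ) : ℂ) := by
      simp [e2]
    rw [e1, e3, Complex.norm_real, Complex.norm_real, Real.norm_of_nonneg (by positivity),
      Real.norm_of_nonneg (by positivity)]
    rcases le_total (p ^ ((σ : ℝ) / 2)) δ with h | h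
    · have : 0 ≤ C * p := by positivity
      linarith
    · have h1 : δ ^ (2 / (σ : ℝ)) ≤ p := by
        have := Real.rpow_le_rpow hδ.le h (by positivity : 0 ≤ 2 / (σ : ℝ))
        rwa [← Real.rpow_mul hp0.le, div_mul_div_cancel₀' hσ'.ne', div_self two_ne_zero,
          Real.rpow_one] at this
      have h2 : p ^ ((σ : ℝ) / 2) ≤ 1 := Real.rpow_le_one hp0.le hp1 (by positivity)
      have h3 : 1 ≤ C * p := by
        rw [hC, inv_mul_eq_div, one_le_div (by positivity)]
        exact h1
      linarith
  refine (norm_fmul_le_norm_fmul key f).trans ?_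
  rw [fmul_add, fmul_smul, fmul_smul, fmul_one]
  refine (norm_add_le _ _).trans ?_
  rw [norm_smul, norm_smul, Complex.norm_real, Complex.norm_real, Real.norm_of_nonneg hδ.le,
    Real.norm_of_nonneg hC0.le]
  rfl

theorem norm_le_J_two_add_lapOp (f : L2 d) : ‖f‖ ≤ ‖J d 2 f‖ + ‖lapOp d f‖ := by
  have h := eq_J_two_sub_sum f
  rw [← lapOp_apply] at h
  have h2 : ‖f - J d 2 f‖ ≤ ‖lapOp d f‖ := by
    have h3 := congrArg norm h
    rw [norm_smul, norm_neg, Complex.norm_real, Real.norm_of_nonneg (by positivity)] at h3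
    rw [← h3]
    refine le_mul_of_one_le_left (norm_nonneg _) ?_
    nlinarith [Real.pi_gt_three]
  linarith [norm_le_norm_add_norm_sub (J d 2 f) f, norm_sub_rev f (J d 2 f)]

variable {r s σ : ℝ≥0} (h₁ : productConst d (r + 1) < ⊤) (h₂ : productConst d (1 + r + 0) < ⊤)
  (h₃ : productConst d (r + s) < ⊤)

/-- The operator `1 - div ((c₀ + b) ∇ ·)` composed with `J² : L² → H²`, where `b = J^(1+r) β`. -/
def ellOp (c₀ : ℝ) (β : L2 d) : L2 d →L[ℂ] L2 d := J d 2 - divOp h₁ h₂ c₀ β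

theorem ellOp_apply (c₀ : ℝ) (β f : L2 d) :
    ellOp h₁ h₂ c₀ β f = J d 2 f - divOp h₁ h₂ c₀ β f := rfl

theorem IsNonneg.inner_ellOp_symm {β : L2 d} (hβ : IsNonneg r β) (c₀ : ℝ) (f f' : L2 d) :
    inner ℂ (J d 2 f) (ellOp h₁ h₂ c₀ β f') = inner ℂ (ellOp h₁ h₂ c₀ β f) (J d 2 f') := by
  have h : inner ℂ (J d 2 f) (divOp h₁ h₂ c₀ β f') = inner ℂ (divOp h₁ h₂ c₀ β f) (J d 2 f') := by
    rw [← inner_conj_symm, inner_divOp, inner_divOp, map_neg, map_sum]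
    simp only [inner_conj_symm, hβ.inner_flux_symm]
  rw [ellOp_apply, ellOp_apply, inner_sub_right, inner_sub_left, h]

theorem IsNonneg.norm_sq_le_inner_ellOp {β : L2 d} (hβ : IsNonneg r β) {c₀ : ℝ} (hc : 0 ≤ c₀)
    (f : L2 d) : ‖J d 2 f‖ ^ 2 ≤ (inner ℂ (ellOp h₁ h₂ c₀ β f) (J d 2 f) : ℂ).re := by
  rw [ellOp_apply, inner_sub_left, inner_divOp, inner_self_eq_norm_sq_to_K, sub_neg_eq_add,
    Complex.add_re, Complex.re_sum]
  have : 0 ≤ ∑ j, (inner ℂ (flux h₂ c₀ β (J d 1 (D j f))) (J d 1 (D j f)) : ℂ).re :=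
    Finset.sum_nonneg fun j _ => hβ.inner_flux_nonneg h₂ hc _
  have e : (((‖J d 2 f‖ : ℝ) : ℂ) ^ 2).re = ‖J d 2 f‖ ^ 2 := by norm_cast
  exact le_of_eq_of_le e.symm (le_add_of_nonneg_right this)

theorem IsNonneg.norm_J_two_le {β : L2 d} (hβ : IsNonneg r β) {c₀ : ℝ} (hc : 0 ≤ c₀) (f : L2 d) :
    ‖J d 2 f‖ ≤ ‖ellOp h₁ h₂ c₀ β f‖ := by
  have h1 := (hβ.norm_sq_le_inner_ellOp h₁ h₂ hc f).trans
    ((Complex.re_le_norm _).trans (norm_inner_le_norm _ _))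
  rcases (norm_nonneg (J d 2 f)).eq_or_lt with h | h
  · rw [← h]; exact norm_nonneg _
  · rw [sq] at h1
    exact le_of_mul_le_mul_right h1 h

/-- The equation in nondivergence form: (c₀ + b)Δv = v - Lv - ∇b·∇v. Since c₀ + b ≥ c₀ pointwise, it
bounds Δv in L². -/
theorem lapOp_flux (c₀ : ℝ) (β f : L2 d) : flux h₂ c₀ β (lapOp d f) =
    J d 2 f - ellOp h₁ h₂ c₀ β f - ∑ j, prodL2 r 1 h₁ (D j β) (D j f) := by
  rw [ellOp_apply, divOp, add_apply, smul_apply, perturbOp_apply, flux]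
  abel

include h₃ in
/-- The a priori estimate `‖v‖_{H²} ≤ C ‖v - div ((c₀ + b) ∇ v)‖_{L²}`. -/
theorem exists_apriori (hs : s + σ = 1) (hσ : 0 < σ) {c₀ : ℝ} (hc : 0 < c₀) (B : ℝ) :
    ∃ C : ℝ, 0 ≤ C ∧ ∀ β : L2 d, IsNonneg r β → ‖β‖ ≤ B →
      ∀ f, ‖f‖ ≤ C * ‖ellOp h₁ h₂ c₀ β f‖ := by
  set P := ‖prodL2 r s h₃‖
  -- M bounds the term ∇b·∇v relative to ‖J^σ f‖ after division by c₀. Interpolation with δ = 1/(2(M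
  -- + 1)) gives Mδ ≤ 1/2, so half of ‖f‖ is absorbed on the left.
  set M := c₀⁻¹ * (d * (P * (2 * Real.pi * |B|) * (2 * Real.pi))) with hM
  have hM0 : 0 ≤ M := by positivity
  obtain ⟨C, hC, hint⟩ := exists_interpolation d hσ (δ := 1 / (2 * (M + 1))) (by positivity)
  refine ⟨2 * (1 + 2 * c₀⁻¹ + M * C), by positivity, fun β hβ hB f => ?_⟩
  set k := ‖ellOp h₁ h₂ c₀ β f‖
  have hJ : ‖J d 2 f‖ ≤ k := hβ.norm_J_two_le h₁ h₂ hc.le f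
  have hterm : ∀ j, ‖prodL2 r 1 h₁ (D j β) (D j f)‖ ≤
      P * (2 * Real.pi * |B|) * (2 * Real.pi) * ‖J d σ f‖ := by
    intro j
    rw [prodL2_J h₁ h₃ hs, J_D]
    calc _ ≤ P * ‖D j β‖ * ‖D j (J d σ f)‖ := (prodL2 r s h₃).le_opNorm₂ _ _
      _ ≤ P * (2 * Real.pi * |B|) * (2 * Real.pi * ‖J d σ f‖) := by
        gcongr
        · refine (norm_D_le j β).trans ?_
          gcongr
          exact hB.trans (le_abs_self B)
        · exact norm_D_le j _
      _ = _ := by ring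
  have hsum : ‖∑ j, prodL2 r 1 h₁ (D j β) (D j f)‖ ≤
      d * (P * (2 * Real.pi * |B|) * (2 * Real.pi)) * ‖J d σ f‖ := by
    refine (norm_sum_le_of_le _ fun j _ => hterm j).trans_eq ?_
    simp
    ring
  have hlap : ‖lapOp d f‖ ≤ c₀⁻¹ * (2 * k) + M * ‖J d σ f‖ := by
    have h := hβ.norm_le_flux h₂ hc.le (lapOp d f)
    rw [lapOp_flux h₁ h₂, mul_comm, ← le_div_iff₀ hc] at h
    have h' : ‖J d 2 f - ellOp h₁ h₂ c₀ β f - ∑ j, prodL2 r 1 h₁ (D j β) (D j f)‖ ≤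
        2 * k + d * (P * (2 * Real.pi * |B|) * (2 * Real.pi)) * ‖J d σ f‖ := by
      refine (norm_sub_le _ _).trans (add_le_add ?_ hsum)
      refine (norm_sub_le _ _).trans ?_
      linarith
    refine h.trans ?_
    rw [hM, div_eq_inv_mul, mul_assoc c₀⁻¹, ← mul_add]
    gcongr
  have h1 := hint f
  have h2 := norm_le_J_two_add_lapOp f
  have h3 : M * ‖J d σ f‖ ≤ M * (1 / (2 * (M + 1))) * ‖f‖ + M * C * k := by
    calc _ ≤ M * (1 / (2 * (M + 1)) * ‖f‖ + C * ‖J d 2 f‖) := by gcongr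
      _ ≤ M * (1 / (2 * (M + 1)) * ‖f‖ + C * k) := by gcongr
      _ = _ := by ring
  have h4 : M * (1 / (2 * (M + 1))) * ‖f‖ ≤ 1 / 2 * ‖f‖ := by
    gcongr
    rw [mul_one_div, div_le_div_iff₀ (by positivity) (by positivity)]
    linarith
  linarith

/-- The symbol is p + 4π²c₀(1 - p) with p = (1 + |ξ|²)⁻¹ in (0, 1], hence at least min(1, 4π²c₀),
and the operator is coercive. -/
theorem isUnit_J_two_sub_lapOp {c₀ : ℝ} (hc : 0 < c₀) : IsUnit (J d 2 - (c₀ : ℂ) • lapOp d) := by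
  have hpi : 0 < 4 * Real.pi ^ 2 := by positivity
  set m := min 1 (c₀ * (4 * Real.pi ^ 2)) with hm
  have hm0 : 0 < m := by positivity
  refine ContinuousLinearMap.isUnit_of_forall_le_norm_inner_map _ (c := ⟨m, hm0.le⟩) hm0 fun f => ?_
  refine le_trans ?_ (Complex.re_le_norm _)
  have hJ : (inner ℂ (J d 2 f) f : ℂ).re = ‖J d 1 f‖ ^ 2 := by
    have e : J d 2 f = J d 1 (J d 1 f) := by rw [J_J, one_add_one_eq_two]
    rw [e, inner_J, inner_self_eq_norm_sq_to_K]
    norm_cast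
  have hL : (inner ℂ (lapOp d f) f : ℂ).re = -∑ j, ‖D j f‖ ^ 2 := by
    rw [lapOp_apply, sum_inner, Complex.re_sum, ← Finset.sum_neg_distrib]
    refine Finset.sum_congr rfl fun j _ => ?_
    rw [inner_D, inner_self_eq_norm_sq_to_K, Complex.neg_re]
    norm_cast
  have hf : 4 * Real.pi ^ 2 * (‖f‖ ^ 2 - ‖J d 1 f‖ ^ 2) = ∑ j, ‖D j f‖ ^ 2 := by
    have h := congrArg (fun g => (inner ℂ g f : ℂ).re) (eq_J_two_sub_sum f)
    have e : (inner ℂ f f : ℂ).re = ‖f‖ ^ 2 := by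
      rw [inner_self_eq_norm_sq_to_K]; norm_cast
    rw [← lapOp_apply, inner_smul_left, Complex.conj_ofReal, Complex.re_ofReal_mul, inner_sub_left,
      inner_neg_left, Complex.sub_re, Complex.neg_re, hL, hJ, e, neg_neg] at h
    exact h
  have e : (inner ℂ ((J d 2 - (c₀ : ℂ) • lapOp d) f) f : ℂ).re =
      ‖J d 1 f‖ ^ 2 + c₀ * ∑ j, ‖D j f‖ ^ 2 := by
    rw [sub_apply, smul_apply, inner_sub_left, inner_smul_left, Complex.conj_ofReal, Complex.sub_re,
      Complex.re_ofReal_mul, hJ, hL]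
    ring
  rw [e, ← hf]
  show ‖f‖ ^ 2 * m ≤ _
  have hle : ‖J d 1 f‖ ^ 2 ≤ ‖f‖ ^ 2 := by
    gcongr
    exact norm_J_le 1 f
  have m1 : m ≤ 1 := min_le_left _ _
  have m2 : m ≤ c₀ * (4 * Real.pi ^ 2) := min_le_right _ _
  nlinarith [mul_le_mul_of_nonneg_right m1 (sq_nonneg ‖J d 1 f‖),
    mul_le_mul_of_nonneg_right m2 (sub_nonneg.2 hle)]

include h₃ in
-- The path from the constant coefficient replaces β by tβ with 0 ≤ t ≤ 1. Sign and norm bound are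
-- preserved, so one a priori constant serves the whole path.
theorem IsNonneg.isUnit_ellOp (hs : s + σ = 1) (hσ : 0 < σ) {c₀ : ℝ} (hc : 0 < c₀) {β : L2 d}
    (hβ : IsNonneg r β) : IsUnit (ellOp h₁ h₂ c₀ β) := by
  obtain ⟨C, _, h⟩ := exists_apriori h₁ h₂ h₃ hs hσ hc ‖β‖
  have e : ∀ β : L2 d, ellOp h₁ h₂ c₀ β = (J d 2 - (c₀ : ℂ) • lapOp d) - perturbOp h₁ h₂ β :=
    fun β => by rw [ellOp, divOp, sub_sub]
  rw [e]
  refine isUnit_of_continuity_method (C := C) (isUnit_J_two_sub_lapOp hc) fun t ht0 ht1 f => ?_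
  rw [← map_smul, ← e]
  refine h _ (hβ.smul ht0) ?_ f
  rw [norm_smul, Complex.norm_real, Real.norm_of_nonneg ht0]
  exact mul_le_of_le_one_left (norm_nonneg _) ht1

/-- The inverse of `1 - div ((c₀ + b) ∇ ·)` on `L²(ℝ^d)`. -/
def resolvent (c₀ : ℝ) (β : L2 d) : L2 d →L[ℂ] L2 d := J d 2 ∘L Ring.inverse (ellOp h₁ h₂ c₀ β)

theorem resolvent_ellOp {c₀ : ℝ} {β : L2 d} (h : IsUnit (ellOp h₁ h₂ c₀ β)) (f : L2 d) :
    resolvent h₁ h₂ c₀ β (ellOp h₁ h₂ c₀ β f) = J d 2 f := by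
  rw [resolvent, ContinuousLinearMap.comp_apply, inverse_apply_self h]

theorem exists_eq_ellOp {c₀ : ℝ} {β : L2 d} (h : IsUnit (ellOp h₁ h₂ c₀ β)) (x : L2 d) :
    ∃ f, ellOp h₁ h₂ c₀ β f = x :=
  ⟨Ring.inverse (ellOp h₁ h₂ c₀ β) x, by
    rw [← mul_apply_eq_comp, Ring.mul_inverse_cancel _ h, one_apply_eq_self]⟩

include h₃ in
-- With T(z) denoting `ellOp` at z, the comparison operator is Q = (T(z) - T(y)) T(y)⁻¹. The
-- difference is linear in β(z) - β(y), and the a priori estimate bounds T(y)⁻¹ uniformly.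
theorem exists_resolventFamily (hs : s + σ = 1) (hσ : 0 < σ) {c₀ : ℝ} (hc : 0 < c₀)
    {β : ℝ → L2 d} (hβ : ∀ z, IsNonneg r (β z)) {B : ℝ} (hB : ∀ z, ‖β z‖ ≤ B) {Λ : ℝ}
    (hΛ : 0 ≤ Λ) (hlip : ∀ z y, ‖β z - β y‖ ≤ Λ * |z - y|) :
    ∃ C, ResolventFamily (fun z => resolvent h₁ h₂ c₀ (β z)) C := by
  obtain ⟨C, hC, hap⟩ := exists_apriori h₁ h₂ h₃ hs hσ hc B
  have hu := fun z => (hβ z).isUnit_ellOp h₁ h₂ h₃ hs hσ hc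
  refine ⟨‖perturbOp h₁ h₂‖ * Λ * C, by positivity, fun z x y => ?_, fun z x => ?_, fun z => ?_,
    fun z y => ?_⟩
  · obtain ⟨f, rfl⟩ := exists_eq_ellOp h₁ h₂ (hu z) x
    obtain ⟨f', rfl⟩ := exists_eq_ellOp h₁ h₂ (hu z) y
    simp only [resolvent_ellOp h₁ h₂ (hu z)]
    exact (hβ z).inner_ellOp_symm h₁ h₂ c₀ f f'
  · obtain ⟨f, rfl⟩ := exists_eq_ellOp h₁ h₂ (hu z) x
    simp only [resolvent_ellOp h₁ h₂ (hu z)]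
    exact (sq_nonneg _).trans ((hβ z).norm_sq_le_inner_ellOp h₁ h₂ hc.le f)
  · refine (denseRange_J 2).mono ?_
    rintro _ ⟨f, rfl⟩
    exact ⟨_, resolvent_ellOp h₁ h₂ (hu z) f⟩
  · refine ⟨(ellOp h₁ h₂ c₀ (β z) - ellOp h₁ h₂ c₀ (β y)) ∘L Ring.inverse (ellOp h₁ h₂ c₀ (β y)),
      fun x => ?_, ?_⟩
    · obtain ⟨f, rfl⟩ := exists_eq_ellOp h₁ h₂ (hu y) x
      rw [ContinuousLinearMap.comp_apply, inverse_apply_self (hu y), sub_apply, map_sub, resolvent_ellOp h₁ h₂ (hu z),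
        resolvent_ellOp h₁ h₂ (hu y)]
    · have e : ellOp h₁ h₂ c₀ (β z) - ellOp h₁ h₂ c₀ (β y) = -perturbOp h₁ h₂ (β z - β y) := by
        simp only [ellOp, divOp, map_sub]
        abel
      have h1 : ‖perturbOp h₁ h₂ (β z - β y)‖ ≤ ‖perturbOp h₁ h₂‖ * (Λ * |z - y|) :=
        ((perturbOp h₁ h₂).le_opNorm _).trans (by gcongr; exact hlip z y)
      have h2 : ‖Ring.inverse (ellOp h₁ h₂ c₀ (β y))‖ ≤ C := by
        refine ContinuousLinearMap.opNorm_le_bound _ hC fun x => ?_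
        obtain ⟨f, rfl⟩ := exists_eq_ellOp h₁ h₂ (hu y) x
        rw [inverse_apply_self (hu y)]
        exact hap _ (hβ y) (hB y) f
      rw [e]
      refine (ContinuousLinearMap.opNorm_comp_le _ _).trans ?_
      rw [norm_neg]
      calc _ ≤ ‖perturbOp h₁ h₂‖ * (Λ * |z - y|) * C := by gcongr
        _ = _ := by ring

end Apriori
end Paraxial
end


noncomputable section
namespace Paraxial

open Filter Topology
open scoped NNReal ENNReal

/-! ### From abstract propagators to evolution systems. -/

section StrongContinuity

variable {H : Type*} [NormedAddCommGroup H] [NormedSpace ℂ H]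

theorem tendsto_apply_of_norm_le_one {ι : Type*} {l : Filter ι} {T : ι → H →L[ℂ] H} {x : ι → H}
    {x₀ y : H} (hT : ∀ᶠ i in l, ‖T i‖ ≤ 1) (hy : Tendsto (fun i => T i x₀) l (𝓝 y))
    (hx : Tendsto x l (𝓝 x₀)) : Tendsto (fun i => T i (x i)) l (𝓝 y) := by
  have h0 : Tendsto (fun i => T i (x i - x₀)) l (𝓝 0) := by
    refine squeeze_zero_norm' (hT.mono fun i hi => ?_) (tendsto_iff_norm_sub_tendsto_zero.1 hx)
    simpa using (T i).le_of_opNorm_le hi (x i - x₀)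
  have := h0.add hy
  rw [zero_add] at this
  exact this.congr fun i => by rw [← map_add, sub_add_cancel]

end StrongContinuity

section AbstractEvolution

variable {H : Type*} [NormedAddCommGroup H] [InnerProductSpace ℂ H]

theorem norm_le_one_of_isometry {T : H →L[ℂ] H} (h : ∀ x, ‖T x‖ = ‖x‖) : ‖T‖ ≤ 1 :=
  T.opNorm_le_bound zero_le_one fun x => by rw [h, one_mul]

/-- The slope of U(z₁,·)v at z₂ is -U(z₁,z) applied to the slope of U(·,z₂)v at z₂, so a derivative
on the diagonal is enough. -/
theorem hasDerivAt_snd_of_fst {U : ℝ → ℝ → H →L[ℂ] H} (hdiag : ∀ s x, U s s x = x)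
    (hnorm : ∀ z s x, ‖U z s x‖ = ‖x‖) (hcomp : ∀ z y s x, U z y (U y s x) = U z s x)
    (hcont : ∀ x, Continuous fun p : ℝ × ℝ => U p.1 p.2 x) (z₁ z₂ : ℝ) {v p : H}
    (hd : HasDerivAt (fun z => U z z₂ v) p z₂) :
    HasDerivAt (fun z => U z₁ z v) (-(U z₁ z₂ p)) z₂ := by
  rw [hasDerivAt_iff_tendsto_slope] at hd ⊢
  have hc : Continuous fun z => U z₁ z p := (hcont p).comp (by fun_prop : Continuous fun z => (z₁, z))
  have h := (tendsto_apply_of_norm_le_one (T := fun z => U z₁ z)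
    (Eventually.of_forall fun z => norm_le_one_of_isometry (hnorm z₁ z))
    ((hc.tendsto z₂).mono_left nhdsWithin_le_nhds) hd).neg
  refine h.congr fun z => ?_
  rw [slope_def_module, slope_def_module, ← Complex.coe_smul, map_smul, map_sub, hcomp, hdiag,
    Complex.coe_smul, ← smul_neg, neg_sub]

theorem continuous_apply_snd {U : ℝ → ℝ → H →L[ℂ] H} (hnorm : ∀ z s x, ‖U z s x‖ = ‖x‖)
    (hcont : ∀ x, Continuous fun p : ℝ × ℝ => U p.1 p.2 x) (z₁ : ℝ) {g : ℝ → H} (hg : Continuous g) :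
    Continuous fun z => U z₁ z (g z) := by
  rw [continuous_iff_continuousAt]
  intro z₂
  have hc : Continuous fun z => U z₁ z (g z₂) :=
    (hcont _).comp (by fun_prop : Continuous fun z => (z₁, z))
  exact tendsto_apply_of_norm_le_one
    (Eventually.of_forall fun z => norm_le_one_of_isometry (hnorm z₁ z)) (hc.tendsto z₂) (hg.tendsto z₂)

theorem contDiff_one_of_hasDerivAt {f f' : ℝ → H} (h : ∀ z, HasDerivAt f (f' z) z)
    (hf' : Continuous f') : ContDiff ℝ 1 f := by
  rw [contDiff_one_iff_deriv]
  refine ⟨fun z => (h z).differentiableAt, ?_⟩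
  rwa [show deriv f = f' from funext fun z => (h z).deriv]

end AbstractEvolution

/-! ### Uniqueness of the evolution system. -/

section Uniqueness

variable {d : ℕ}

theorem OpGraph.unique {a : E d → ℝ} {v w w' : L2 d} (h : OpGraph a v w) (h' : OpGraph a v w') :
    w = w' := by
  obtain ⟨g, q, h1, h2, h3⟩ := (isDivGrad_iff a v w).1 h.2
  obtain ⟨g', q', h1', h2', h3'⟩ := (isDivGrad_iff a v w').1 h'.2
  have hg : ∀ j, g j = g' j := fun j => J_injective 1 ((h1 j).symm.trans (h1' j))
  have hq : ∀ j, q j = q' j := fun j => by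
    refine Lp.ext ?_
    filter_upwards [h2 j, h2' j] with x k1 k2
    rw [k1, k2, hg]
  simp only [hq, h3'] at h3
  exact (J_injective 1 h3).symm

theorem dense_memH2 : Dense {v : L2 d | MemH2 v} := by
  refine (denseRange_J (d := d) 2).mono ?_
  rintro _ ⟨f, rfl⟩
  exact (memH2_iff _).2 ⟨f, rfl⟩

/-- By the product rule z ↦ V(z₁,z)U(z,z₂)v has derivative -V iA U v + V iA U v = 0. Its values at
z₂ and z₁ are V(z₁,z₂)v and U(z₁,z₂)v. -/
theorem IsEvolutionSystem.unique {Z : ℝ} {a : ℝ → E d → ℝ} {U V : ℝ → ℝ → L2 d →L[ℂ] L2 d}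
    (hU : IsEvolutionSystem Z a U) (hV : IsEvolutionSystem Z a V) {z₁ z₂ : ℝ} (h2 : 0 ≤ z₂)
    (h21 : z₂ ≤ z₁) (h1 : z₁ ≤ Z) : V z₁ z₂ = U z₁ z₂ := by
  have key : ∀ v, MemH2 v → V z₁ z₂ v = U z₁ z₂ v := by
    intro v hv
    have hd : ∀ z ∈ Icc z₂ z₁, HasDerivWithinAt (fun z => V z₁ z (U z z₂ v)) 0 (Icc z₂ z₁) z := by
      intro z hz
      have hz0 : 0 ≤ z := h2.trans hz.1
      have hzZ : z ≤ Z := hz.2.trans h1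
      obtain ⟨w, hw, hwd⟩ := hU.deriv_fst z z₂ h2 hz.1 hzZ v hv
      obtain ⟨w', hw', hwd'⟩ := hV.deriv_snd z₁ z hz0 hz.2 h1 _ (hU.invariant z z₂ h2 hz.1 hzZ v hv)
      obtain rfl := hw.unique hw'
      have d1 := hwd.mono (Icc_subset_Icc_right h1 : Icc z₂ z₁ ⊆ Icc z₂ Z)
      have d2 := hwd'.mono (Icc_subset_Icc_left h2 : Icc z₂ z₁ ⊆ Icc 0 z₁)
      rw [hasDerivWithinAt_iff_tendsto_slope] at d1 d2 ⊢
      have hmem : ∀ᶠ y in 𝓝[Icc z₂ z₁ \ {z}] z, y ∈ Icc z₂ z₁ :=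
        eventually_nhdsWithin_of_forall fun y hy => hy.1
      have hsc : Tendsto (fun y => V z₁ y (Complex.I • w)) (𝓝[Icc z₂ z₁ \ {z}] z)
          (𝓝 (V z₁ z (Complex.I • w))) := by
        have hc := hV.strongly_continuous (Complex.I • w) (z₁, z) ⟨hz0, hz.2, h1⟩
        have hpair : Tendsto (fun y => (z₁, y)) (𝓝[Icc z₂ z₁ \ {z}] z)
            (𝓝[{p : ℝ × ℝ | 0 ≤ p.2 ∧ p.2 ≤ p.1 ∧ p.1 ≤ Z}] (z₁, z)) := by
          refine tendsto_nhdsWithin_iff.2 ⟨?_, hmem.mono fun y hy => ⟨h2.trans hy.1, hy.2, h1⟩⟩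
          exact ((by fun_prop : Continuous fun y : ℝ => (z₁, y)).tendsto z).mono_left
            nhdsWithin_le_nhds
        exact hc.tendsto.comp hpair
      have h3 := (tendsto_apply_of_norm_le_one (T := fun y => V z₁ y)
        (hmem.mono fun y hy => hV.contractive z₁ y (h2.trans hy.1) hy.2 h1) hsc d1).add d2
      rw [add_neg_cancel] at h3
      refine h3.congr fun y => ?_
      rw [slope_def_module, slope_def_module, slope_def_module,
        (V z₁ y).map_smul_of_tower ((y - z)⁻¹), ← smul_add, map_sub, sub_add_sub_cancel]
    have hconst := (convex_Icc z₂ z₁).norm_image_sub_le_of_norm_hasDerivWithin_le hd (C := 0)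
      (fun _ _ => by simp) (left_mem_Icc.2 h21) (right_mem_Icc.2 h21)
    rw [zero_mul, norm_le_zero_iff, sub_eq_zero, hV.diag z₁ ⟨h2.trans h21, h1⟩,
      hU.diag z₂ ⟨h2, h21.trans h1⟩] at hconst
    exact hconst.symm
  refine ContinuousLinearMap.ext fun v => ?_
  exact congrFun ((V z₁ z₂).continuous.ext_on dense_memH2 (U z₁ z₂).continuous key) v

end Uniqueness

/-! ### Existence for the given coefficient. -/

section Existence

variable {d : ℕ} {r s σ : ℝ≥0}

theorem exists_evolutionSystem (h₁ : productConst d (r + 1) < ⊤)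
    (h₂ : productConst d (1 + r + 0) < ⊤) (h₃ : productConst d (r + s) < ⊤)
    (hs : s + σ = 1) (hσ : 0 < σ) {c₀ : ℝ} (hc : 0 < c₀) {β : ℝ → L2 d} (hβ : ∀ z, IsNonneg r (β z))
    {B : ℝ} (hB : ∀ z, ‖β z‖ ≤ B) {Λ : ℝ} (hΛ : 0 ≤ Λ) (hlip : ∀ z y, ‖β z - β y‖ ≤ Λ * |z - y|)
    {Z : ℝ} {a : ℝ → E d → ℝ}
    (ha : ∀ z ∈ Icc 0 Z, ∀ᵐ x, (a z x : ℂ) = (c₀ : ℂ) + J d (1 + r) (β z) x) :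
    ∃ U, IsEvolutionSystem Z a U := by
  obtain ⟨C, hR⟩ := exists_resolventFamily h₁ h₂ h₃ hs hσ hc hβ hB hΛ hlip
  have hu := fun z => (hβ z).isUnit_ellOp h₁ h₂ h₃ hs hσ hc
  have hRe : ∀ z f, resolvent h₁ h₂ c₀ (β z) (ellOp h₁ h₂ c₀ (β z) f) = J d 2 f := fun z f =>
    resolvent_ellOp h₁ h₂ (hu z) f
  have hmem : ∀ z x, MemH2 (resolvent h₁ h₂ c₀ (β z) x) := fun z x =>
    (memH2_iff _).2 ⟨_, rfl⟩
  have hop : ∀ z ∈ Icc 0 Z, ∀ x, OpGraph (a z) (resolvent h₁ h₂ c₀ (β z) x)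
      (resolvent h₁ h₂ c₀ (β z) x - x) := by
    intro z hz x
    obtain ⟨f, rfl⟩ := exists_eq_ellOp h₁ h₂ (hu z) x
    refine ⟨hmem z _, ?_⟩
    rw [hRe, isDivGrad_J_two_iff h₁ h₂ (ha z hz), ellOp_apply, sub_sub_cancel]
  have hβc : Continuous β := by
    refine (LipschitzWith.of_dist_le_mul (K := Λ.toNNReal) fun z y => ?_).continuous
    rw [dist_eq_norm, Real.dist_eq, Real.coe_toNNReal _ hΛ]
    exact hlip z y
  have hellc : ∀ f, Continuous fun z => ellOp h₁ h₂ c₀ (β z) f := by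
    intro f
    simp only [ellOp_apply, divOp, add_apply]
    fun_prop
  obtain ⟨U, hdiag, hnorm, hcomp, hcont, hder⟩ := hR.exists_evolution
  have hsnd : ∀ z₁ z f, HasDerivAt (fun z => U z₁ z (J d 2 f))
      (-(U z₁ z (Complex.I • (J d 2 f - ellOp h₁ h₂ c₀ (β z) f)))) z := by
    intro z₁ z f
    obtain ⟨w, _, hw, hwd⟩ := hder z (ellOp h₁ h₂ c₀ (β z) f)
    simp only [hRe] at hw hwd
    -- On the diagonal U is the identity, so injectivity of the resolvent identifies w(z) with
    -- L(z)v, and the derivative there is iA(z)v.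
    have hwz : w z = ellOp h₁ h₂ c₀ (β z) f := by
      apply hR.injective z
      simp only [hRe, ← hw, hdiag]
    have := hwd z
    rw [hwz, hdiag] at this
    exact hasDerivAt_snd_of_fst hdiag hnorm hcomp hcont z₁ z this
  refine ⟨U, ⟨fun v => (hcont v).continuousOn, fun z _ => ContinuousLinearMap.ext (hdiag z),
    fun z₁ z₂ _ _ _ => norm_le_one_of_isometry (hnorm z₁ z₂),
    fun z₁ z₂ z₃ _ _ _ _ => ContinuousLinearMap.ext fun v => hcomp z₁ z₂ z₃ v, ?_, ?_, ?_, ?_, ?_⟩⟩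
  · intro z₁ z₂ _ _ _ v hv
    obtain ⟨f, rfl⟩ := (memH2_iff v).1 hv
    obtain ⟨w, _, hw, _⟩ := hder z₂ (ellOp h₁ h₂ c₀ (β z₂) f)
    simp only [hRe] at hw
    rw [hw]
    exact hmem _ _
  · intro v hv z₂ _
    obtain ⟨f, rfl⟩ := (memH2_iff v).1 hv
    obtain ⟨w, hwc, _, hwd⟩ := hder z₂ (ellOp h₁ h₂ c₀ (β z₂) f)
    simp only [hRe] at hwd
    have hc : Continuous fun z => U z z₂ (J d 2 f) :=
      (hcont _).comp (by fun_prop : Continuous fun z => (z, z₂))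
    have hc' : Continuous fun z => Complex.I • (U z z₂ (J d 2 f) - w z) :=
      (hc.sub hwc).const_smul Complex.I
    exact (contDiff_one_of_hasDerivAt hwd hc').contDiffOn
  · intro v hv z₁ _
    obtain ⟨f, rfl⟩ := (memH2_iff v).1 hv
    have hg : Continuous fun z => Complex.I • (J d 2 f - ellOp h₁ h₂ c₀ (β z) f) :=
      (continuous_const.sub (hellc f)).const_smul Complex.I
    have hn : Continuous fun z => -(U z₁ z (Complex.I • (J d 2 f - ellOp h₁ h₂ c₀ (β z) f))) :=
      (continuous_apply_snd hnorm hcont z₁ hg).neg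
    exact (contDiff_one_of_hasDerivAt (fun z => hsnd z₁ z f) hn).contDiffOn
  · intro z₁ z₂ h2 h21 h1 v hv
    obtain ⟨f, rfl⟩ := (memH2_iff v).1 hv
    obtain ⟨w, _, hw, hwd⟩ := hder z₂ (ellOp h₁ h₂ c₀ (β z₂) f)
    simp only [hRe] at hw hwd
    refine ⟨U z₁ z₂ (J d 2 f) - w z₁, ?_, (hwd z₁).hasDerivWithinAt⟩
    rw [hw]
    exact hop z₁ ⟨h2.trans h21, h1⟩ _
  · intro z₁ z₂ h2 h21 h1 v hv
    obtain ⟨f, rfl⟩ := (memH2_iff v).1 hv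
    refine ⟨J d 2 f - ellOp h₁ h₂ c₀ (β z₂) f, ?_, (hsnd z₁ z₂ f).hasDerivWithinAt⟩
    have := hop z₂ ⟨h2, h21.trans h1⟩ (ellOp h₁ h₂ c₀ (β z₂) f)
    rwa [hRe] at this

theorem Sobolev.J_bessel {t : ℝ} (p : ℝ≥0) (hp : (p : ℝ) = t) {u : Sobolev d t} {f : E d → ℝ}
    (h : u.IsRepresentedBy f) : ∀ᵐ x, J d p (Sobolev.bessel u) x = (f x : ℂ) := by
  subst hp
  obtain ⟨F, hF, hu⟩ := h
  have : F = J d p (Sobolev.bessel u) := by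
    apply L2.ext_distribution
    rw [coe_eq_J_iff, Sobolev.coe_bessel, hu]
  rwa [← this]

theorem Sobolev.norm_bessel_sub {t : ℝ} (u v : Sobolev d t) :
    ‖Sobolev.bessel u - Sobolev.bessel v‖ = ‖u - v‖ := by
  rw [← map_sub]
  rfl

theorem L2.coeFn_sum {ι : Type*} (s : Finset ι) (f : ι → L2 d) :
    ((∑ i ∈ s, f i : L2 d) : E d → ℂ) =ᵐ[volume] fun x => ∑ i ∈ s, f i x := by
  induction s using Finset.cons_induction with
  | empty => exact Lp.coeFn_zero ℂ 2 volume
  | cons i s hi ih =>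
    simp only [Finset.sum_cons]
    filter_upwards [Lp.coeFn_add (f i) (∑ j ∈ s, f j), ih] with x h1 h2
    rw [h1, Pi.add_apply, h2]

/-- A C¹ function into H^(r+1) is Lipschitz on [0, Z], and for fixed τ only the numbers h l τ enter.
-/
theorem CoeffAssumption.exists_lipschitz_profile {N : ℕ} {m c₀ : ℝ} {c : Fin N → ℝ → E d → ℝ}
    {h : Fin N → ℝ → ℝ} (hc : CoeffAssumption m r c₀ c h) {Z : ℝ} (hZ : 0 < Z) (τ : ℝ) :
    ∃ (β : ℝ → L2 d) (Λ : ℝ), 0 ≤ Λ ∧ (∀ z, IsNonneg r (β z)) ∧ (∀ z, ‖β z‖ ≤ ‖β 0‖ + Λ * Z) ∧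
      (∀ z y, ‖β z - β y‖ ≤ Λ * |z - y|) ∧
      ∀ z ∈ Icc 0 Z, ∀ᵐ x, (coeff c₀ c h τ z x : ℂ) = (c₀ : ℂ) + J d (1 + r) (β z) x := by
  choose γ hγ hγc using hc.lateral_regularity
  choose K hK using fun l => ((hγ l).mono (Icc_subset_Ici_self : Icc 0 Z ⊆ Ici 0)).exists_lipschitzOnWith
    one_ne_zero (convex_Icc 0 Z) isCompact_Icc
  -- The abstract theory uses all real z. Composing with the 1-Lipschitz projection onto [0, Z]
  -- extends the coefficient and keeps its bounds.
  set p : ℝ → ℝ := fun z => projIcc 0 Z hZ.le z with hp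
  have hpm : ∀ z, p z ∈ Icc 0 Z := fun z => (projIcc 0 Z hZ.le z).2
  have hpl : ∀ z y, |p z - p y| ≤ |z - y| := fun z y => abs_projIcc_sub_projIcc hZ.le
  set β : ℝ → L2 d := fun z => ∑ l, (h l τ : ℂ) • Sobolev.bessel (γ l (p z)) with hβ
  set Λ : ℝ := ∑ l, |h l τ| * K l with hΛdef
  have hΛ : 0 ≤ Λ := by positivity
  have hlip' : ∀ z y, ‖β z - β y‖ ≤ Λ * |p z - p y| := by
    intro z y
    rw [hβ, ← Finset.sum_sub_distrib, hΛdef, Finset.sum_mul]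
    refine norm_sum_le_of_le _ fun l _ => ?_
    rw [← smul_sub, norm_smul, Complex.norm_real, Real.norm_eq_abs, Sobolev.norm_bessel_sub, mul_assoc]
    gcongr
    simpa only [dist_eq_norm, Real.norm_eq_abs] using (hK l).dist_le_mul _ (hpm z) _ (hpm y)
  have hJ : ∀ z, ∀ᵐ x, (coeff c₀ c h τ (p z) x : ℂ) = (c₀ : ℂ) + J d (1 + r) (β z) x := by
    intro z
    have h1 : ∀ᵐ x, ∀ l, J d (1 + r) (Sobolev.bessel (γ l (p z))) x = (c l (p z) x : ℂ) :=
      ae_all_iff.2 fun l => Sobolev.J_bessel (1 + r) (by push_cast; ring) (hγc l _ (hpm z).1)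
    have h2 : J d (1 + r) (β z) = ∑ l, (h l τ : ℂ) • J d (1 + r) (Sobolev.bessel (γ l (p z))) := by
      simp only [hβ, map_sum, map_smul]
    have h3 : ∀ᵐ x, ∀ l, ((h l τ : ℂ) • J d (1 + r) (Sobolev.bessel (γ l (p z))) : L2 d) x =
        (h l τ : ℂ) * J d (1 + r) (Sobolev.bessel (γ l (p z))) x :=
      ae_all_iff.2 fun l => Lp.coeFn_smul _ _
    rw [h2]
    filter_upwards [h1, h3, L2.coeFn_sum Finset.univ
      (fun l => (h l τ : ℂ) • J d (1 + r) (Sobolev.bessel (γ l (p z))))] with x k1 k3 k4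
    rw [k4]
    simp only [k3, k1, coeff]
    push_cast
    simp only [mul_comm]
  refine ⟨β, Λ, hΛ, fun z => ?_, fun z => ?_, fun z y => ?_, fun z hz => ?_⟩
  · filter_upwards [hJ z, hc.lower_bound (p z) (hpm z).1 τ] with x k1 k2
    refine ⟨coeff c₀ c h τ (p z) x - c₀, sub_nonneg.2 k2, ?_⟩
    rw [Complex.ofReal_sub, k1, add_sub_cancel_left]
  · have h1 := hlip' z 0
    have h2 : |p z - p 0| ≤ Z := by
      rw [abs_le]
      constructor <;> linarith [(hpm z).1, (hpm z).2, (hpm 0).1, (hpm 0).2]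
    have h3 := mul_le_mul_of_nonneg_left h2 hΛ
    linarith [norm_le_norm_add_norm_sub (β 0) (β z), norm_sub_rev (β 0) (β z)]
  · exact (hlip' z y).trans (mul_le_mul_of_nonneg_left (hpl z y) hΛ)
  · have := hJ z
    rwa [show p z = z from congrArg Subtype.val (projIcc_of_mem hZ.le hz)] at this

end Existence
end Paraxial
end

theorem mainTheorem3 {d N : ℕ} (hd : d = 1 ∨ d = 2) (m r c₀ : ℝ)
    (c : Fin N → ℝ → Paraxial.E d → ℝ) (h : Fin N → ℝ → ℝ)
    (hc : Paraxial.CoeffAssumption m r c₀ c h) (Z : ℝ) (hZ : 0 < Z) (τ : ℝ) :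
    ∃ U : ℝ → ℝ → Paraxial.L2 d →L[ℂ] Paraxial.L2 d,
      Paraxial.IsEvolutionSystem Z (Paraxial.coeff c₀ c h τ) U ∧
      ∀ V : ℝ → ℝ → Paraxial.L2 d →L[ℂ] Paraxial.L2 d,
        Paraxial.IsEvolutionSystem Z (Paraxial.coeff c₀ c h τ) V →
        ∀ z₁ z₂ : ℝ, 0 ≤ z₂ → z₂ ≤ z₁ → z₁ ≤ Z → V z₁ z₂ = U z₁ z₂ := by
  obtain ⟨hr0, hr1⟩ := hc.r_mem
  lift r to NNReal using hr0.le
  have hd2 : (d : ℝ) ≤ 2 := by rcases hd with rfl | rfl <;> norm_num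
  -- With σ = r/2 and s = 1 - σ, one has r + s = 1 + r/2 > 1 ≥ d/2 while s < 1. The bound d ≤ 2
  -- enters through this choice.
  set σ : NNReal := r / 2
  have hσ : (σ : ℝ) = r / 2 := by simp [σ]
  have hσ0 : 0 < σ := by rw [← NNReal.coe_pos, hσ]; linarith
  have hσ1 : σ ≤ 1 := by rw [← NNReal.coe_le_coe, hσ, NNReal.coe_one]; linarith
  have hs : ((1 - σ : NNReal) : ℝ) = 1 - r / 2 := by rw [NNReal.coe_sub hσ1, hσ, NNReal.coe_one]
  obtain ⟨β, Λ, hΛ, hβ, hB, hlip, ha⟩ := hc.exists_lipschitz_profile hZ τ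
  obtain ⟨U, hU⟩ := Paraxial.exists_evolutionSystem (s := 1 - σ)
    (Paraxial.productConst_lt_top (by push_cast; linarith))
    (Paraxial.productConst_lt_top (by push_cast; linarith))
    (Paraxial.productConst_lt_top (by rw [NNReal.coe_add, hs]; linarith))
    (tsub_add_cancel_of_le hσ1) hσ0 hc.c₀_pos hβ hB hΛ hlip ha
  exact ⟨U, hU, fun V hV z₁ z₂ h2 h21 h1 => hU.unique hV h2 h21 h1⟩
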